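/- Let $\mathbb K$ be a field of characteristic zero. **Forests.** Let $\mathcal{OF}$ be the $\mathbb K$-vector space with basis the ordered forests (finite sequences, possibly empty, of planar rooted trees), with concatenation product, empty forest $\emptyset$, single-vertex tree $\bullet$, and $B^+(\omega)$ the tree obtained by attaching the trees of $\omega$ in order to a new root. For forests $u,\omega$ let $u\rhd\omega$ (left grafting) be the sum over all ways to add, for each tree of $u$, one edge from some vertex of $\omega$ to the root of that tree, the new edges being placed to the left of the old edges at each vertex and trees of $u$ grafted onto the same vertex keeping their order; in particular $B^+(\omega)=\omega\rhd\bullet$. Let $Lie(\mathcal{PT})\subset\mathcal{OF}$ be the Lie subalgebra (for the commutator) generated by the planar rooted trees; a Lie monomial is an iterated bracket of trees. **The Hopf algebra $\mathcal H_N=(\mathcal{OF},\sqcup\!\sqcup ,\Delta_N)$.** Its product is the shuffle product of forests, its unit is $\emptyset$, its counit $\epsilon_N$ is the coefficient of $\emptyset$. The coproduct is $\Delta_N(\omega)=\sum_c P^c\otimes B^-(R^c)$, where $c$ runs over the sets of edges of the tree $B^+(\omega)$ that contain at most one edge of each path from the root to a leaf and, with an edge, all edges to its left at the same vertex. Here $R^c$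 is the component containing the root, $B^-$ deletes the root, and $P^c$ is the shuffle product of the forests that are cut off from the different vertices (trees cut off from the same vertex being concatenated in order). **Substitution.** For a forest, or a Lie monomial, $\omega'$ whose $n$ vertices are labelled bijectively by $1,\dots,n$, and for $\omega_1,\dots,\omega_n\in Lie(\mathcal{PT})$, write $\omega'$ in terms of concatenation (respectively Lie brackets), left grafting and single-vertex trees, by means of $B^+(\omega)=\omega\rhd\bullet$, and let $\omega_1\cdots\omega_n\circ\omega'$ be the element of $\mathcal{OF}$ (respectively of $Lie(\mathcal{PT})$) obtained by replacing vertex $i$ by $\omega_i$ for all $i$. Write $[\omega']$ for $\omega'$ with the labels forgotten. **The bialgebra $\mathcal Q$ and the coaction.** Fix any basis $\mathcal B$ of the vector space $Lie(\mathcal{PT})$ that consists of Lie monomials. Let $S(Lie(\mathcal{PT}))$ be the symmetric algebra, with product $\centerdot$ and unit $1$. Define an algebra morphism $\Delta_{\mathcal Q}:S(Lie(\mathcal{PT}))\to S(Lie(\mathcal{PT}))\otimes S(Lie(\mathcal{PT}))$ and a linear map $\rho:\mathcal{OF}\to S(Lie(\mathcal{PT}))\otimes\mathcal{OF}$ by $$\Delta_{\mathcal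 Q}(b)=\sum_{\omega'}\sum_{b_1,\dots,b_n\in\mathcal B}\frac1{n!}\,\langle b,\ b_1\cdots b_n\circ\omega'\rangle_{\mathcal B}\ b_1\centerdot\cdots\centerdot b_n\otimes[\omega']\qquad(b\in\mathcal B),$$ $$\rho(\omega)=\sum_{\omega'}\sum_{b_1,\dots,b_n\in\mathcal B}\frac1{n!}\,\langle\omega,\ b_1\cdots b_n\circ\omega'\rangle\ b_1\centerdot\cdots\centerdot b_n\otimes[\omega']\qquad(\omega\text{ an ordered forest}).$$ In the first formula $\omega'$ runs over all labellings of the Lie monomials in $\mathcal B$ and $\langle b,x\rangle_{\mathcal B}$ is the coefficient of $b$ in the expansion of $x$ in $\mathcal B$; in the second, $\omega'$ runs over all labelled ordered forests and $\langle\omega,x\rangle$ is the coefficient of $\omega$ in $x$; in both, $n$ is the number of vertices of $\omega'$. All these sums have finitely many non-zero terms. Let $\epsilon_{\mathcal Q}:S(Lie(\mathcal{PT}))\to\mathbb K$ be the algebra morphism that is $1$ on $\bullet$ and $0$ on all other Lie monomials. **Proposition.** $\mathcal Q=(S(Lie(\mathcal{PT})),\centerdot,1,\Delta_{\mathcal Q},\epsilon_{\mathcal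 Q})$ and $\mathcal H_N=(\mathcal{OF},\sqcup\!\sqcup ,\emptyset,\Delta_N,\epsilon_N)$ are bialgebras, and they are in cointeraction via $\rho$. That is, $\rho$ is a left coaction of $\mathcal Q$ on $\mathcal{OF}$, $$(\Delta_{\mathcal Q}\otimes Id)\rho=(Id\otimes\rho)\rho,\qquad(\epsilon_{\mathcal Q}\otimes Id)\rho=Id,$$ and for all $x,y\in\mathcal{OF}$ $$\rho(\emptyset)=1\otimes\emptyset,\qquad\rho(x\sqcup\!\sqcup y)=\rho(x)\,\rho(y),\qquad(Id\otimes\epsilon_N)\rho(x)=\epsilon_N(x)\,1,\qquad(Id\otimes\Delta_N)\rho=m^{1,3}(\rho\otimes\rho)\Delta_N,$$ where $\rho(x)\rho(y)$ uses the product $\centerdot$ on the first and $\sqcup\!\sqcup $ on the second tensor factor, and $m^{1,3}(a\otimes b\otimes c\otimes d)=a\centerdot c\otimes b\otimes d$. -/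

import Mathlib

open scoped TensorProduct

noncomputable section

namespace LieButcher

/-! ### Planar rooted trees and ordered forests -/

/-- A planar rooted tree: a root together with the ordered list (from left to right) of the
subtrees attached to it. -/
inductive PTree : Type
  | node : List PTree → PTree

/-- An ordered forest: a finite sequence of planar rooted trees. The empty forest is `[]`. -/
abbrev Forest : Type := List PTree

/-- The tree with a single vertex. -/
def bullet : PTree := PTree.node []

mutual
/-- The set of vertices of a planar rooted tree (`none` is the root). -/
def PTree.Vert : PTree → Type
  | .node c => Option (forestVert c)
/-- The set of vertices of an ordered forest. -/
def forestVert : List PTree → Type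
  | [] => Empty
  | t :: w => PTree.Vert t ⊕ forestVert w
end

mutual
/-- A tree has finitely many vertices. -/
@[reducible] def PTree.vertFintype : (t : PTree) → Fintype (PTree.Vert t)
  | .node c => @instFintypeOption _ (forestVertFintype c)
/-- A forest has finitely many vertices. -/
@[reducible] def forestVertFintype : (w : List PTree) → Fintype (forestVert w)
  | [] => inferInstanceAs (Fintype Empty)
  | t :: w => @instFintypeSum _ _ (PTree.vertFintype t) (forestVertFintype w)
end

instance (t : PTree) : Fintype (PTree.Vert t) := PTree.vertFintype t
instance (w : List PTree) : Fintype (forestVert w) := forestVertFintype w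

/-! ### Combinatorial operations; a list of results stands for their sum -/

/-- All ways to split a sequence into two complementary subsequences (the terms of the shuffle
coproduct). -/
def deshuffles {α : Type} : List α → List (List α × List α)
  | [] => [([], [])]
  | a :: u => (deshuffles u).flatMap fun pq => [(a :: pq.1, pq.2), (pq.1, a :: pq.2)]

/-- All shuffles of two sequences, with multiplicity. -/
def shuffles {α : Type} : List α → List α → List (List α)
  | [], v => [v]
  | a :: u, [] => [a :: u]
  | a :: u, b :: v =>
      (shuffles u (b :: v)).map (a :: ·) ++ (shuffles (a :: u) v).map (b :: ·)
termination_by u v => u.length + v.length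

mutual
/-- Left grafting of a forest `u` onto a tree: all ways to add, for every tree of `u`, one edge
from some vertex of the target to the root of that tree. The new edges are placed to the left of
the old edges at each vertex, and trees of `u` that are grafted onto the same vertex keep their
order. -/
def graftTree : Forest → PTree → List PTree
  | u, .node c => (deshuffles u).flatMap fun pq =>
      (graftForest pq.2 c).map fun d => PTree.node (pq.1 ++ d)
/-- Left grafting of a forest onto a forest; in particular the empty forest acts as the identity
and a nonempty forest grafted onto the empty one gives zero. -/
def graftForest : Forest → Forest → List Forest
  | [], [] => [[]]
  | _ :: _, [] => []
  | u, t :: w => (deshuffles u).flatMap fun pq =>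
      (graftTree pq.1 t).flatMap fun s => (graftForest pq.2 w).map fun r => s :: r
end

mutual
/-- The planar left admissible cuts `c` of a tree. The cut is recorded by the terms of
`P^c ⊗ R^c`. -/
def treeCuts : PTree → List (Forest × PTree)
  | .node c => (rootCuts [] c).map fun pr => (pr.1, PTree.node pr.2)
/-- The left admissible cuts inside the trees of a forest `w` (viewed as the sequence of trees
attached to a vertex) that do not cut an edge above the roots of `w`. The parts that are cut off
from different vertices are shuffled. -/
def innerCuts : Forest → List (Forest × Forest)
  | [] => [([], [])]
  | t :: w => (treeCuts t).flatMap fun ps => (innerCuts w).flatMap fun qr =>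
      (shuffles ps.1 qr.1).map fun x => (x, ps.2 :: qr.2)
/-- The left admissible cuts of the tree whose root carries the subtrees `u ++ w` such that all the
edges from the root to `u` (and possibly to some further subtrees, a prefix of `w`) are cut; the
subtrees cut off from the root are concatenated in order and shuffled with the rest. The right
component is the forest that remains after deleting the root. -/
def rootCuts : Forest → Forest → List (Forest × Forest)
  | u, [] => [(u, [])]
  | u, t :: w =>
      ((treeCuts t).flatMap fun ps => (innerCuts w).flatMap fun qr =>
        (shuffles ps.1 qr.1).flatMap fun x => (shuffles u x).map fun y => (y, ps.2 :: qr.2)) ++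
      rootCuts (u ++ [t]) w
end

/-! ### The space of ordered forests -/

section Algebra

variable (K : Type*) [Field K]

/-- The vector space spanned by ordered forests, with concatenation as its product and (hence) with
the commutator as its Lie bracket. -/
abbrev OF : Type _ := MonoidAlgebra K (FreeMonoid PTree)

/-- The commutator bracket. -/
instance : LieRing (OF K) := LieRing.ofAssociativeRing
instance : LieAlgebra K (OF K) := LieAlgebra.ofAssociativeAlgebra

/-- A forest as a basis vector. -/
def forest (w : Forest) : OF K := MonoidAlgebra.single (FreeMonoid.ofList w) 1

/-- The basis of ordered forests. -/
def forestBasis : Module.Basis Forest K (OF K) :=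
  (Module.Basis.ofRepr (MonoidAlgebra.coeffLinearEquiv K)).reindex FreeMonoid.toList

/-- The sum of the forests in a list. -/
def forestSum (l : List Forest) : OF K := (l.map (forest K)).sum

/-- The bilinear map on forests with prescribed values on basis vectors. -/
def bilin {M : Type*} [AddCommGroup M] [Module K M] (f : Forest → Forest → M) :
    OF K →ₗ[K] OF K →ₗ[K] M :=
  (forestBasis K).constr K fun u => (forestBasis K).constr K fun w => f u w

/-- The left grafting product on forests. -/
def graft : OF K →ₗ[K] OF K →ₗ[K] OF K :=
  bilin K fun u w => forestSum K (graftForest u w)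

/-- The shuffle product on forests. -/
def shuffle : OF K →ₗ[K] OF K →ₗ[K] OF K :=
  bilin K fun u w => forestSum K (shuffles u w)

/-- The coefficient of the forest `w`. -/
def coeff (w : Forest) : OF K →ₗ[K] K := (forestBasis K).coord w

/-- The coproduct of the Munthe-Kaas–Wright Hopf algebra: the sum of `P^c ⊗ R^c` over all left
admissible cuts (where cutting off the whole forest is allowed). -/
def deltaN : OF K →ₗ[K] OF K ⊗[K] OF K :=
  (forestBasis K).constr K fun w =>
    ((rootCuts [] w).map fun pr => forest K pr.1 ⊗ₜ[K] forest K pr.2).sum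

/-- The space `Lie(PT)` of Lie polynomials of planar rooted trees, inside its enveloping algebra:
the Lie subalgebra of the free associative algebra on planar trees that is generated by the
trees. -/
def LiePT : LieSubalgebra K (OF K) :=
  LieSubalgebra.lieSpan K (OF K) (Set.range fun t : PTree => forest K [t])

/-- A tree as an element of `Lie(PT)`. -/
def treeLie (t : PTree) : LiePT K :=
  ⟨forest K [t], LieSubalgebra.subset_lieSpan ⟨t, rfl⟩⟩

/-! ### Substitution of Lie polynomials into vertices -/

variable {K}

mutual
/-- Substitution of `f v` for the vertex `v` of a tree. The tree with root `r` and branches `c` is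
`c ▷ r`. -/
def substTree : (t : PTree) → (PTree.Vert t → OF K) → OF K
  | .node c, f => graft K (substForest c fun v => f (some v)) (f none)
/-- Substitution of `f v` for the vertex `v` of a forest. -/
def substForest : (w : List PTree) → (forestVert w → OF K) → OF K
  | [], _ => 1
  | t :: w, f => substTree t (fun v => f (Sum.inl v)) * substForest w (fun v => f (Sum.inr v))
end

end Algebra

/-! ### Lie monomials -/

/-- A (formal) Lie monomial in planar trees: a complete bracketing of a sequence of trees. -/
abbrev LieMonomial : Type := FreeMagma PTree

/-- The vertices of a Lie monomial. -/
def LieMonomial.Vert : LieMonomial → Type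
  | .of t => PTree.Vert t
  | .mul x y => LieMonomial.Vert x ⊕ LieMonomial.Vert y

/-- A Lie monomial has finitely many vertices. -/
@[reducible] def LieMonomial.vertFintype : (m : LieMonomial) → Fintype (LieMonomial.Vert m)
  | .of t => PTree.vertFintype t
  | .mul x y =>
      @instFintypeSum _ _ (LieMonomial.vertFintype x) (LieMonomial.vertFintype y)

instance (m : LieMonomial) : Fintype (LieMonomial.Vert m) := LieMonomial.vertFintype m

section Algebra

variable (K : Type*) [Field K]

/-- The Lie polynomial given by a Lie monomial. -/
def LieMonomial.eval : LieMonomial → LiePT K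
  | .of t => treeLie K t
  | .mul x y => ⁅LieMonomial.eval x, LieMonomial.eval y⁆

variable {K}

/-- Substitution of `f v` for the vertex `v` of a Lie monomial. -/
def LieMonomial.subst : (m : LieMonomial) → (LieMonomial.Vert m → OF K) → OF K
  | .of t, f => substTree t f
  | .mul x y, f =>
      ⁅LieMonomial.subst x (fun v => f (Sum.inl v)), LieMonomial.subst y (fun v => f (Sum.inr v))⁆

end Algebra

/-! ### Substituting Lie polynomials into a Lie monomial gives a Lie polynomial -/

section Closure

theorem sum_flatMap {α M : Type*} [AddCommMonoid M] (l : List α) (f : α → List M) :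
    (l.flatMap f).sum = (l.map fun a => (f a).sum).sum := by
  induction l with
  | nil => rfl
  | cons a l ih => simp [ih]

theorem deshuffles_sum_swap {α : Type} {M : Type*} [AddCommMonoid M] (w : List α)
    (g : List α → List α → M) :
    ((deshuffles w).map fun pq => g pq.1 pq.2).sum =
      ((deshuffles w).map fun pq => g pq.2 pq.1).sum := by
  induction w generalizing g with
  | nil => simp [deshuffles]
  | cons a w ih =>
    have h := ih fun p q => g (a :: p) q + g p (a :: q)
    simp only [deshuffles, List.map_flatMap, sum_flatMap, List.map_cons, List.map_nil,
      List.sum_cons, List.sum_nil, add_zero]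
    rw [h]
    simp only [add_comm]

theorem deshuffles_sum_assoc {α : Type} {M : Type*} [AddCommMonoid M] (w : List α)
    (g : List α → List α → List α → M) :
    ((deshuffles w).map fun pq => ((deshuffles pq.1).map fun rs => g rs.1 rs.2 pq.2).sum).sum =
      ((deshuffles w).map fun pq =>
        ((deshuffles pq.2).map fun rs => g pq.1 rs.1 rs.2).sum).sum := by
  induction w generalizing g with
  | nil => simp [deshuffles]
  | cons a w ih =>
    have h := ih fun p q r => g (a :: p) q r + g p (a :: q) r + g p q (a :: r)
    simp only [deshuffles, List.map_flatMap, sum_flatMap, List.map_cons, List.map_nil,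
      List.sum_cons, List.sum_nil, add_zero, List.sum_map_add] at h ⊢
    simp only [add_assoc] at h ⊢
    exact h

theorem deshuffles_sum_nil {α : Type} {M : Type*} [AddCommMonoid M] (w : List α)
    (g : List α → List α → M) (hg : ∀ a p q, g (a :: p) q = 0) :
    ((deshuffles w).map fun pq => g pq.1 pq.2).sum = g [] w := by
  induction w generalizing g with
  | nil => simp [deshuffles]
  | cons a w ih =>
    simp only [deshuffles, List.map_flatMap, sum_flatMap, List.map_cons, List.map_nil,
      List.sum_cons, List.sum_nil, add_zero, hg, zero_add]
    exact ih (fun p q => g p (a :: q)) fun b p q => hg b p _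

variable (K : Type*) [Field K]

theorem forestBasis_apply (w : Forest) : forestBasis K w = forest K w := by
  simp [forestBasis, forest]

theorem forest_append (u w : Forest) : forest K (u ++ w) = forest K u * forest K w := by
  simp [forest, MonoidAlgebra.single_mul_single]

theorem forest_nil : forest K [] = 1 := rfl

theorem graft_forest (u w : Forest) :
    graft K (forest K u) (forest K w) = forestSum K (graftForest u w) := by
  rw [graft, bilin, ← forestBasis_apply, ← forestBasis_apply, Module.Basis.constr_basis,
    Module.Basis.constr_basis]

theorem forestSum_cons (u : Forest) (t : PTree) (w : Forest) :
    forestSum K (graftForest u (t :: w)) = ((deshuffles u).map fun pq =>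
      forestSum K ((graftTree pq.1 t).map fun s => [s]) *
        forestSum K (graftForest pq.2 w)).sum := by
  have key (l : List PTree) (m : List Forest) :
      ((l.flatMap fun s => m.map fun r => s :: r).map (forest K)).sum =
        ((l.map fun s => [s]).map (forest K)).sum * (m.map (forest K)).sum := by
    induction l with
    | nil => simp
    | cons s l ih =>
      simp only [List.flatMap_cons, List.map_append, List.sum_append, ih, List.map_cons,
        List.sum_cons, add_mul, List.map_map]
      congr 1
      rw [← List.sum_map_mul_left]
      congr 1
      apply List.map_congr_left
      intro r _
      exact forest_append K [s] r
  simp only [forestSum, graftForest, List.map_flatMap, sum_flatMap]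
  congr 1
  apply List.map_congr_left
  intro pq _
  rw [← key, List.map_flatMap]
  simp [sum_flatMap]

theorem graft_mul_forest (w u v : Forest) :
    graft K (forest K w) (forest K u * forest K v) = ((deshuffles w).map fun pq =>
      graft K (forest K pq.1) (forest K u) * graft K (forest K pq.2) (forest K v)).sum := by
  rw [← forest_append]
  simp only [graft_forest]
  induction u generalizing w with
  | nil =>
    rw [deshuffles_sum_nil w fun p q =>
      forestSum K (graftForest p []) * forestSum K (graftForest q v)]
    · simp [graftForest, forestSum, forest_nil]
    · intro a p q
      simp [graftForest, forestSum]
  | cons t u ih =>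
    simp only [List.cons_append, forestSum_cons, ih]
    have h := deshuffles_sum_assoc w fun p q r =>
      forestSum K ((graftTree p t).map fun s => [s]) * forestSum K (graftForest q u) *
        forestSum K (graftForest r v)
    have e1 (r : OF K) (l : List (Forest × Forest)) :
        (l.map fun rs => forestSum K ((graftTree rs.1 t).map fun s => [s]) *
          forestSum K (graftForest rs.2 u) * r).sum = (l.map fun rs =>
            forestSum K ((graftTree rs.1 t).map fun s => [s]) *
              forestSum K (graftForest rs.2 u)).sum * r := List.sum_map_mul_right ..
    have e2 (a : OF K) (l : List (Forest × Forest)) :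
        (l.map fun rs => a * forestSum K (graftForest rs.1 u) *
          forestSum K (graftForest rs.2 v)).sum = a * (l.map fun rs =>
            forestSum K (graftForest rs.1 u) * forestSum K (graftForest rs.2 v)).sum := by
      simp only [mul_assoc]
      exact List.sum_map_mul_left ..
    simp only [e1, e2] at h
    exact h.symm

theorem graft_mul (w : Forest) (x y : OF K) :
    graft K (forest K w) (x * y) = ((deshuffles w).map fun pq =>
      graft K (forest K pq.1) x * graft K (forest K pq.2) y).sum := by
  have hx : x ∈ Submodule.span K (Set.range (forestBasis K)) := by
    rw [Module.Basis.span_eq]; trivial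
  have hy : y ∈ Submodule.span K (Set.range (forestBasis K)) := by
    rw [Module.Basis.span_eq]; trivial
  induction hx using Submodule.span_induction with
  | mem x hx =>
    obtain ⟨u, rfl⟩ := hx
    induction hy using Submodule.span_induction with
    | mem y hy =>
      obtain ⟨v, rfl⟩ := hy
      rw [forestBasis_apply, forestBasis_apply, graft_mul_forest]
    | zero => simp
    | add a b _ _ ha hb => simp only [mul_add, map_add, ha, hb, List.sum_map_add]
    | smul c a _ ha =>
      simp only [mul_smul_comm, map_smul, ha, List.smul_sum, List.map_map]
      rfl
  | zero => simp
  | add a b _ _ ha hb => simp only [add_mul, map_add, ha, hb, List.sum_map_add]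
  | smul c a _ ha =>
    simp only [smul_mul_assoc, map_smul, ha, List.smul_sum, List.map_map]
    rfl

theorem list_sum_mem_LiePT {l : List (OF K)} (h : ∀ x ∈ l, x ∈ LiePT K) : l.sum ∈ LiePT K :=
  list_sum_mem (S := (LiePT K).toSubmodule) h

/-- `Lie(PT)` is stable under left grafting of arbitrary forests. -/
theorem graft_mem (x : OF K) {y : OF K} (hy : y ∈ LiePT K) : graft K x y ∈ LiePT K := by
  have main (w : Forest) : graft K (forest K w) y ∈ LiePT K := by
    induction hy using LieSubalgebra.lieSpan_induction generalizing w with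
    | mem y hy =>
      obtain ⟨t, rfl⟩ := hy
      simp only [graft_forest, forestSum_cons]
      apply list_sum_mem_LiePT
      intro z hz
      obtain ⟨⟨p, q⟩, _, rfl⟩ := List.mem_map.1 hz
      rcases q with _ | ⟨a, q⟩
      · simp only [graftForest, forestSum, List.map_cons, List.map_nil, List.sum_cons,
          List.sum_nil, add_zero, forest_nil, mul_one, List.map_map]
        apply list_sum_mem_LiePT
        intro z hz
        obtain ⟨s, _, rfl⟩ := List.mem_map.1 hz
        exact LieSubalgebra.subset_lieSpan ⟨s, rfl⟩
      · simp [graftForest, forestSum]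
    | zero => rw [map_zero]; exact (LiePT K).zero_mem
    | add a b _ _ ha hb => rw [map_add]; exact (LiePT K).add_mem (ha w) (hb w)
    | smul c a _ ha => rw [map_smul]; exact (LiePT K).smul_mem c (ha w)
    | lie a b _ _ ha hb =>
      have h : graft K (forest K w) ⁅a, b⁆ = ((deshuffles w).map fun pq =>
          ⁅graft K (forest K pq.1) a, graft K (forest K pq.2) b⁆).sum := by
        rw [Ring.lie_def, map_sub, graft_mul, graft_mul,
          deshuffles_sum_swap w fun p q => graft K (forest K p) b * graft K (forest K q) a]
        simp only [Ring.lie_def, sub_eq_add_neg, List.sum_map_add, List.sum_neg, List.map_map]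
        rfl
      rw [h]
      apply list_sum_mem_LiePT
      intro z hz
      obtain ⟨pq, _, rfl⟩ := List.mem_map.1 hz
      exact (LiePT K).lie_mem (ha _) (hb _)
  have hx : x ∈ Submodule.span K (Set.range (forestBasis K)) := by
    rw [Module.Basis.span_eq]; trivial
  induction hx using Submodule.span_induction with
  | mem x hx => obtain ⟨w, rfl⟩ := hx; rw [forestBasis_apply]; exact main w
  | zero => rw [map_zero]; exact (LiePT K).zero_mem
  | add a b _ _ ha hb => rw [map_add]; exact (LiePT K).add_mem ha hb
  | smul c a _ ha => rw [map_smul]; exact (LiePT K).smul_mem c ha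

variable {K}

theorem LieMonomial.subst_mem (m : LieMonomial) (f : LieMonomial.Vert m → OF K)
    (hf : ∀ v, f v ∈ LiePT K) : LieMonomial.subst m f ∈ LiePT K := by
  induction m with
  | of t =>
    cases t with
    | node c =>
      simp only [LieMonomial.subst, substTree]
      exact graft_mem K _ (hf none)
  | mul x y hx hy =>
    exact (LiePT K).lie_mem (hx _ fun v => hf (Sum.inl v)) (hy _ fun v => hf (Sum.inr v))

end Closure

/-! ### The bialgebra `Q` and the coaction -/

section Cointeraction

variable (K : Type*) [Field K]

/-- The symmetric algebra of `Lie(PT)`. -/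
abbrev Q : Type _ := SymmetricAlgebra K (LiePT K)

variable {K} {ι : Type*} (β : ι → LieMonomial) (b : Module.Basis ι K (LiePT K))

open Classical in
/-- The coproduct of `Q` on a basis element `b i`: the sum, over all labelled Lie monomials `β j`
(with `n` vertices and the labelling `σ`) of the basis and over all `n`-tuples `b (k 1), …, b (k n)`
of basis elements, of `1/n!` times the coefficient of `b i` in the composition
`b (k 1) ⋯ b (k n) ∘ β j`, times `b (k 1) ⋯ b (k n) ⊗ b j`. Composition preserves the number of
vertices, so that only finitely many terms do not vanish. -/
def deltaQBasis (i : ι) : Q K ⊗[K] Q K :=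
  ∑ᶠ j : ι, ∑ σ : LieMonomial.Vert (β j) ≃ Fin (Fintype.card (LieMonomial.Vert (β j))),
    ∑ᶠ k : Fin (Fintype.card (LieMonomial.Vert (β j))) → ι,
      (((Nat.factorial (Fintype.card (LieMonomial.Vert (β j))) : ℕ) : K)⁻¹ *
        b.repr ⟨LieMonomial.subst (β j) fun v => (b (k (σ v)) : OF K),
          LieMonomial.subst_mem _ _ fun v => (b (k (σ v))).2⟩ i) •
      ((∏ l, SymmetricAlgebra.ι K (LiePT K) (b (k l))) ⊗ₜ[K] SymmetricAlgebra.ι K (LiePT K) (b j))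

/-- The coproduct of `Q`. -/
def deltaQ : Q K →ₐ[K] Q K ⊗[K] Q K :=
  SymmetricAlgebra.lift (b.constr K (deltaQBasis β b))

/-- The counit of `Q`: it is multiplicative, and on `Lie(PT)` it is the linear form with value `1`
on the single-vertex tree and `0` on all other Lie monomials. -/
def epsilonQ : Q K →ₐ[K] K :=
  SymmetricAlgebra.lift (coeff K [bullet] ∘ₗ (LiePT K).toSubmodule.subtype)

open Classical in
/-- The coaction on a forest `w`: the sum, over all labelled forests `u` (with `n` vertices and the
labelling `σ`) and over all `n`-tuples of basis elements of `Lie(PT)`, of `1/n!` times the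
coefficient of `w` in the composition `b (k 1) ⋯ b (k n) ∘ u`, times `b (k 1) ⋯ b (k n) ⊗ u`. Only
finitely many terms do not vanish. -/
def rhoForest (w : Forest) : Q K ⊗[K] OF K :=
  ∑ᶠ u : Forest, ∑ σ : forestVert u ≃ Fin (Fintype.card (forestVert u)),
    ∑ᶠ k : Fin (Fintype.card (forestVert u)) → ι,
      (((Nat.factorial (Fintype.card (forestVert u)) : ℕ) : K)⁻¹ *
        coeff K w (substForest u fun v => (b (k (σ v)) : OF K))) •
      ((∏ l, SymmetricAlgebra.ι K (LiePT K) (b (k l))) ⊗ₜ[K] forest K u)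

/-- The coaction `H_N → Q ⊗ H_N`. -/
def rho : OF K →ₗ[K] Q K ⊗[K] OF K :=
  (forestBasis K).constr K (rhoForest b)

end Cointeraction

/-! ### Bialgebras and bialgebras in cointeraction -/

section Axioms

variable {K : Type*} [Field K]
variable {A : Type*} [AddCommGroup A] [Module K A] {B : Type*} [AddCommGroup B] [Module K B]

/-- The given product, unit, coproduct and counit form a bialgebra. -/
structure IsBialgebra (mul : A →ₗ[K] A →ₗ[K] A) (one : A) (Δ : A →ₗ[K] A ⊗[K] A)
    (ε : A →ₗ[K] K) : Prop where
  mul_assoc : ∀ x y z, mul (mul x y) z = mul x (mul y z)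
  one_mul : ∀ x, mul one x = x
  mul_one : ∀ x, mul x one = x
  coassoc : ∀ x, TensorProduct.assoc K A A A (Δ.rTensor A (Δ x)) = Δ.lTensor A (Δ x)
  counit_left : ∀ x, TensorProduct.lid K A (ε.rTensor A (Δ x)) = x
  counit_right : ∀ x, TensorProduct.rid K A (ε.lTensor A (Δ x)) = x
  comul_mul : ∀ x y, Δ (mul x y) = TensorProduct.map₂ mul mul (Δ x) (Δ y)
  counit_mul : ∀ x y, ε (mul x y) = ε x * ε y
  comul_one : Δ one = one ⊗ₜ[K] one
  counit_one : ε one = 1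

/-- The map `m^{1,3} : (B ⊗ A) ⊗ (B ⊗ A) → B ⊗ (A ⊗ A)`,
`(a ⊗ b) ⊗ (c ⊗ d) ↦ (a * c) ⊗ (b ⊗ d)`. -/
def mul13 (A : Type*) [AddCommGroup A] [Module K A] (mulB : B →ₗ[K] B →ₗ[K] B) :
    (B ⊗[K] A) ⊗[K] (B ⊗[K] A) →ₗ[K] B ⊗[K] (A ⊗[K] A) :=
  (TensorProduct.lift mulB).rTensor (A ⊗[K] A) ∘ₗ
    (TensorProduct.tensorTensorTensorComm K B A B A).toLinearMap

/-- The bialgebras `A` and `B` are in cointeraction through the left coaction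
`ρ : A → B ⊗ A` of `B` on `A`. -/
structure InCointeraction
    (mulA : A →ₗ[K] A →ₗ[K] A) (oneA : A) (ΔA : A →ₗ[K] A ⊗[K] A) (εA : A →ₗ[K] K)
    (mulB : B →ₗ[K] B →ₗ[K] B) (oneB : B) (ΔB : B →ₗ[K] B ⊗[K] B) (εB : B →ₗ[K] K)
    (ρ : A →ₗ[K] B ⊗[K] A) : Prop where
  bialgebra_left : IsBialgebra mulA oneA ΔA εA
  bialgebra_right : IsBialgebra mulB oneB ΔB εB
  coaction_coassoc :
    ∀ x, TensorProduct.assoc K B B A (ΔB.rTensor A (ρ x)) = ρ.lTensor B (ρ x)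
  coaction_counit : ∀ x, TensorProduct.lid K A (εB.rTensor A (ρ x)) = x
  map_one : ρ oneA = oneB ⊗ₜ[K] oneA
  map_mul : ∀ x y, ρ (mulA x y) = TensorProduct.map₂ mulB mulA (ρ x) (ρ y)
  map_counit : ∀ x, TensorProduct.rid K B (εA.lTensor B (ρ x)) = εA x • oneB
  map_comul :
    ∀ x, ΔA.lTensor B (ρ x) = mul13 A mulB (TensorProduct.map ρ ρ (ΔA x))

end Axioms

end LieButcher

end

/-!
An element of the (completed) algebra of forests with coefficients in a commutative ring `R` is
recorded as a function `A : Forest → R`, its series of coefficients. Everything rests on one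
operation: the substitution of a series `A` for every vertex of a forest `u`, with coefficients
`seriesForest A u w`. By definition it sends the single-vertex tree to `A`, concatenation to
concatenation and `B⁺(c)` to the left grafting of the image of `c` onto `A`. Its transpose `coact A`
sends a function `f` of forests to `w ↦ ∑ u, seriesForest A u w • f u`.

If `A` is primitive for deshuffling, then substitution respects the whole structure of the forest
algebra, and dually `coact A` commutes with

* deconcatenation (`coact_decon_self`), for every `A` without constant term,
* the shuffle product (`shuf_coact`),
* the coproduct dual to left grafting, a sum over cuts that keep the roots (`coact_prune_self`),
* the coproduct `Δ_N`, dual to the Grossman–Larson product (`coact_cut_self`).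

These statements are proved by induction on the number of vertices, from the dual forms of the
axioms of a post-Lie enveloping algebra: `shuf_prune`, `prune_decon`, and `prune_prune`, which
expresses `u ▷ (v ▷ x) = (u ∗ v) ▷ x`. The same identities show that `H_N` is a bialgebra. As a
consequence substitutions compose: substituting `A` into the result of substituting `B` is the
substitution of the series `coact A B` (`coact_seriesForest`).

The connection with the coaction and with the coproduct of `Q` is the generic Lie polynomial
`generic b = ∑ i, b i ⊗ b i`, a primitive series with coefficients in `Q`. Summing over labellings
cancels the factors `1/n!`, and by multilinearity the sum over tuples of basis elements becomes the
substitution of `generic b`. As left grafting is dual to `prune` (`coeff_graft`), this gives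
`ρ w = coact (generic b) (1 ⊗ ·) w` on forests (`rho_forest`), and the coproduct of `Q` maps the
coefficients of `generic b` to `coact (generic b) (1 ⊗ generic b)` (`deltaQ_generic`). These
coefficients span `Lie(PT)` (`eq_of_forall_generic`), because the basis is homogeneous for the
number of vertices. So the coproduct of `Q` is dual to the composition of substitutions
(`deltaQ_seriesForest`), which gives both its coassociativity and that of `ρ`
(`assoc_deltaQ_coact`), while the compatibility of `ρ` with the product, the unit, the counit and
the coproduct of `H_N` is that of `coact (generic b)`.
-/

noncomputable section

namespace LieButcher

/-! ### Sums over lists of combinatorial terms -/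

section Sums

variable {α γ : Type*} {M N : Type*} [AddCommMonoid M] [AddCommMonoid N]

/-- The sum of the values of a function on the entries of a list, with multiplicity. -/
def lsum (l : List α) (F : α → M) : M := (l.map F).sum

@[simp] theorem lsum_nil (F : α → M) : lsum [] F = 0 := rfl

@[simp] theorem lsum_cons (a : α) (l : List α) (F : α → M) :
    lsum (a :: l) F = F a + lsum l F := by simp [lsum]

theorem lsum_append (l l' : List α) (F : α → M) : lsum (l ++ l') F = lsum l F + lsum l' F := by
  simp [lsum]

theorem lsum_map (l : List γ) (g : γ → α) (F : α → M) :
    lsum (l.map g) F = lsum l fun c => F (g c) := by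
  simp [lsum, Function.comp_def]

theorem lsum_flatMap (l : List γ) (g : γ → List α) (F : α → M) :
    lsum (l.flatMap g) F = lsum l fun c => lsum (g c) F := by
  induction l with
  | nil => rfl
  | cons c l ih => simp [lsum_append, ih]

theorem lsum_add (l : List α) (F G : α → M) :
    (lsum l fun a => F a + G a) = lsum l F + lsum l G := by
  simp [lsum, List.sum_map_add]

theorem lsum_zero (l : List α) : (lsum l fun _ => (0 : M)) = 0 := by simp [lsum]

theorem lsum_congr {l : List α} {F G : α → M} (h : ∀ a ∈ l, F a = G a) : lsum l F = lsum l G := by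
  rw [lsum, lsum, List.map_congr_left h]

theorem lsum_comm (l : List α) (l' : List γ) (F : α → γ → M) :
    (lsum l fun a => lsum l' fun c => F a c) = lsum l' fun c => lsum l fun a => F a c := by
  induction l with
  | nil => simp [lsum_zero]
  | cons a l ih => simp [lsum_add, ih]

theorem map_lsum {F : Type*} [FunLike F M N] [AddMonoidHomClass F M N] (g : F) (l : List α)
    (f : α → M) : g (lsum l f) = lsum l fun a => g (f a) := by
  simp [lsum, map_list_sum, Function.comp_def]

theorem smul_lsum {R : Type*} [DistribSMul R M] (r : R) (l : List α) (f : α → M) :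
    r • lsum l f = lsum l fun a => r • f a := by
  induction l with
  | nil => simp
  | cons a l ih => simp [ih]

theorem lsum_smul {R : Type*} [Semiring R] [Module R M] (l : List α) (f : α → R) (m : M) :
    lsum l f • m = lsum l fun a => f a • m := by
  induction l with
  | nil => simp
  | cons a l ih => simp [ih, add_smul]

theorem lsum_mul {R : Type*} [NonUnitalNonAssocSemiring R] (l : List α) (f : α → R) (r : R) :
    lsum l f * r = lsum l fun a => f a * r := by
  induction l with
  | nil => simp
  | cons a l ih => simp [ih, add_mul]

theorem mul_lsum {R : Type*} [NonUnitalNonAssocSemiring R] (l : List α) (f : α → R) (r : R) :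
    r * lsum l f = lsum l fun a => r * f a := by
  induction l with
  | nil => simp
  | cons a l ih => simp [ih, mul_add]

/-! ### Shuffles and deconcatenations -/

/-- All ways to write a list as a concatenation of two lists. -/
def splits : List α → List (List α × List α)
  | [] => [([], [])]
  | a :: w => ([], a :: w) :: (splits w).map fun p => (a :: p.1, p.2)

/-- The sum of `H u v` over all decompositions `w = u ++ v`. -/
def decon (w : List α) (H : List α → List α → M) : M := lsum (splits w) fun p => H p.1 p.2

/-- The sum of the values of a function over all shuffles of two lists. -/
def shuf {α : Type} (x y : List α) (f : List α → M) : M := lsum (shuffles x y) f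

/-- The value `m` on the empty list and `0` on all other lists. -/
def onNil : List α → M → M
  | [], m => m
  | _ :: _, _ => 0

@[simp] theorem onNil_nil (m : M) : onNil ([] : List α) m = m := rfl
@[simp] theorem onNil_cons (a : α) (w : List α) (m : M) : onNil (a :: w) m = 0 := rfl
@[simp] theorem onNil_zero (w : List α) : onNil w (0 : M) = 0 := by cases w <;> rfl

theorem decon_congr {w : List α} {H H' : List α → List α → M} (h : ∀ u v, H u v = H' u v) :
    decon w H = decon w H' := lsum_congr fun _ _ => h _ _

theorem append_of_mem_splits {w : List α} {p : List α × List α} (h : p ∈ splits w) :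
    p.1 ++ p.2 = w := by
  induction w generalizing p with
  | nil => simp_all [splits]
  | cons a w ih =>
    simp only [splits, List.mem_cons, List.mem_map] at h
    rcases h with rfl | ⟨q, hq, rfl⟩
    · rfl
    · simp [ih hq]

theorem decon_congr_of_append {w : List α} {H H' : List α → List α → M}
    (h : ∀ u v, u ++ v = w → H u v = H' u v) : decon w H = decon w H' :=
  lsum_congr fun _ hp => h _ _ (append_of_mem_splits hp)

@[simp] theorem decon_nil (H : List α → List α → M) : decon [] H = H [] [] := by
  simp [decon, splits]

@[simp] theorem decon_cons (a : α) (w : List α) (H : List α → List α → M) :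
    decon (a :: w) H = H [] (a :: w) + decon w fun u v => H (a :: u) v := by
  simp [decon, splits, lsum_map]

theorem decon_add (w : List α) (H H' : List α → List α → M) :
    (decon w fun u v => H u v + H' u v) = decon w H + decon w H' := lsum_add _ _ _

theorem decon_zero (w : List α) : (decon w fun _ _ => (0 : M)) = 0 := lsum_zero _

theorem decon_assoc (w : List α) (F : List α → List α → List α → M) :
    (decon w fun u v => decon u fun a b => F a b v) =
      decon w fun a v => decon v fun b c => F a b c := by
  induction w generalizing F with
  | nil => simp
  | cons t w ih =>
    simp only [decon_cons, decon_nil, decon_add]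
    rw [ih fun a b c => F (t :: a) b c, add_assoc]

theorem decon_onNil_left (w : List α) (f : List α → M) :
    (decon w fun u v => onNil u (f v)) = f w := by
  cases w <;> simp [decon_zero]

theorem decon_onNil_right (w : List α) (f : List α → M) :
    (decon w fun u v => onNil v (f u)) = f w := by
  induction w generalizing f with
  | nil => simp
  | cons t w ih => simp [ih fun u => f (t :: u)]

end Sums

section Shuffles

variable {α : Type} {M : Type*} [AddCommMonoid M]

theorem shuf_congr {x y : List α} {f g : List α → M} (h : ∀ w, f w = g w) :
    shuf x y f = shuf x y g := lsum_congr fun _ _ => h _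

@[simp] theorem shuf_nil_left (y : List α) (f : List α → M) : shuf [] y f = f y := by
  simp [shuf, shuffles]

@[simp] theorem shuf_nil_right (x : List α) (f : List α → M) : shuf x [] f = f x := by
  cases x <;> simp [shuf, shuffles]

theorem shuf_cons_cons (a b : α) (x y : List α) (f : List α → M) :
    shuf (a :: x) (b :: y) f =
      (shuf x (b :: y) fun w => f (a :: w)) + shuf (a :: x) y fun w => f (b :: w) := by
  simp [shuf, shuffles, lsum_append, lsum_map]

theorem shuf_add (x y : List α) (f g : List α → M) :
    (shuf x y fun w => f w + g w) = shuf x y f + shuf x y g := lsum_add _ _ _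

theorem shuf_zero (x y : List α) : (shuf x y fun _ => (0 : M)) = 0 := lsum_zero _

theorem shuf_comm (x y : List α) (f : List α → M) : shuf x y f = shuf y x f := by
  induction x generalizing y f with
  | nil => simp
  | cons a x ihx =>
    induction y generalizing f with
    | nil => simp
    | cons b y ihy => rw [shuf_cons_cons, shuf_cons_cons, ihx, ihy, add_comm]

theorem shuf_assoc (x y z : List α) (f : List α → M) :
    (shuf x y fun w => shuf w z f) = shuf y z fun w => shuf x w f := by
  induction x generalizing y z f with
  | nil => simp
  | cons a x ihx =>
    induction y generalizing z f with
    | nil => simp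
    | cons b y ihy =>
      induction z generalizing f with
      | nil => simp
      | cons c z ihz =>
        have h1 := ihx (b :: y) (c :: z) fun w => f (a :: w)
        have h2 := ihy (c :: z) fun w => f (b :: w)
        have h3 := ihz fun w => f (c :: w)
        simp only [shuf_cons_cons, shuf_add] at h1 h2 h3 ⊢
        rw [h1, h2, add_add_add_comm, h3]
        abel

theorem shuf_onNil (x y : List α) (m : M) :
    (shuf x y fun w => onNil w m) = onNil x (onNil y m) := by
  cases x <;> cases y <;> simp [shuf_cons_cons, shuf_zero]

/-- The shuffle product of four sequences does not depend on how they are paired. -/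
theorem shuf_interchange (x y p q : List α) (f : List α → M) :
    (shuf x y fun u => shuf p q fun v => shuf u v f) =
      shuf x p fun u => shuf y q fun v => shuf u v f := by
  have key (y p q : List α) (g : List α → M) : (shuf p q fun v => shuf y v g) =
      shuf y q fun v => shuf p v g := by
    rw [← shuf_assoc, ← shuf_assoc]
    exact shuf_comm _ _ _
  calc _ = shuf p q fun v => shuf x y fun u => shuf u v f := lsum_comm _ _ _
    _ = shuf p q fun v => shuf y v fun u => shuf x u f := shuf_congr fun v => shuf_assoc _ _ _ _
    _ = shuf y q fun v => shuf p v fun u => shuf x u f := key _ _ _ _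
    _ = shuf y q fun v => shuf x p fun u => shuf u v f :=
        shuf_congr fun v => (shuf_assoc _ _ _ _).symm
    _ = _ := lsum_comm _ _ _

/-- Deconcatenation is multiplicative for the shuffle product. -/
theorem shuf_decon (x y : List α) (H : List α → List α → M) :
    (shuf x y fun w => decon w H) = decon x fun x₁ x₂ => decon y fun y₁ y₂ =>
      shuf x₁ y₁ fun u => shuf x₂ y₂ fun v => H u v := by
  induction x generalizing y H with
  | nil => simp
  | cons a x ihx =>
    induction y generalizing H with
    | nil => simp
    | cons b y ihy =>
      have h1 := ihx (b :: y) fun u v => H (a :: u) v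
      have h2 := ihy fun u v => H (b :: u) v
      simp only [shuf_cons_cons, decon_cons, decon_add, shuf_add, shuf_nil_left,
        shuf_nil_right] at h1 h2 ⊢
      rw [h1, h2]
      abel

end Shuffles

/-! ### Cuts as sums -/

section Cuts

variable {M : Type*} [AddCommMonoid M]

/-- The sum of `H p q` over the left admissible cuts of the forest `w` that keep its roots; here
`p` is cut off and `q` remains. This is the coproduct dual to left grafting. -/
def prune (w : Forest) (H : Forest → Forest → M) : M := lsum (innerCuts w) fun a => H a.1 a.2

/-- The sum of `H p q` over the left admissible cuts of the forest `w`; here `p` is cut off and `q`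
remains. This is the coproduct `deltaN`. -/
def cut (w : Forest) (H : Forest → Forest → M) : M := lsum (rootCuts [] w) fun a => H a.1 a.2

theorem prune_congr {w : Forest} {H H' : Forest → Forest → M} (h : ∀ u v, H u v = H' u v) :
    prune w H = prune w H' := lsum_congr fun _ _ => h _ _

theorem cut_congr {w : Forest} {H H' : Forest → Forest → M} (h : ∀ u v, H u v = H' u v) :
    cut w H = cut w H' := lsum_congr fun _ _ => h _ _

theorem prune_add (w : Forest) (H H' : Forest → Forest → M) :
    (prune w fun u v => H u v + H' u v) = prune w H + prune w H' := lsum_add _ _ _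

theorem cut_add (w : Forest) (H H' : Forest → Forest → M) :
    (cut w fun u v => H u v + H' u v) = cut w H + cut w H' := lsum_add _ _ _

theorem prune_zero (w : Forest) : (prune w fun _ _ => (0 : M)) = 0 := lsum_zero _

theorem cut_zero (w : Forest) : (cut w fun _ _ => (0 : M)) = 0 := lsum_zero _

/-- Ordered forests are binary trees: a nonempty forest is given by the branches `c` of its first
root and the remaining forest `d`. -/
theorem forest_induction {P : Forest → Prop} (nil : P [])
    (cons : ∀ c d : Forest, P c → P d → P (PTree.node c :: d)) (w : Forest) : P w :=
  PTree.rec_1 (motive_1 := fun t => ∃ c, t = .node c ∧ P c) (motive_2 := P)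
    (fun c hc => ⟨c, rfl, hc⟩) nil
    (fun t d ht hd => by obtain ⟨c, rfl, hc⟩ := ht; exact cons c d hc hd) w

@[simp] theorem prune_nil (H : Forest → Forest → M) : prune [] H = H [] [] := by
  simp [prune, innerCuts]

/-- A cut inside the first tree is a cut of its branches; what it cuts off is shuffled with what is
cut off from the other trees. -/
theorem prune_cons (c d : Forest) (H : Forest → Forest → M) :
    prune (PTree.node c :: d) H = cut c fun p r => prune d fun p' q => shuf p p' fun a =>
      H a (PTree.node r :: q) := by
  simp [prune, cut, shuf, innerCuts, treeCuts, lsum_flatMap, lsum_map]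

/-- A left admissible cut of a forest splits off some of its first trees and keeps the roots of the
others. -/
theorem cut_eq (w : Forest) (G : Forest → Forest → M) :
    cut w G = decon w fun u v => prune v fun p q => shuf u p fun a => G a q := by
  have key (x : Forest) : (lsum (rootCuts x w) fun a => G a.1 a.2) =
      decon w fun u v => prune v fun p q => shuf (x ++ u) p fun a => G a q := by
    induction w generalizing x with
    | nil => simp [rootCuts]
    | cons t w ih =>
      simp only [rootCuts, lsum_append, ih, decon_cons, List.append_nil, List.append_assoc,
        List.singleton_append]
      simp [prune, shuf, innerCuts, lsum_flatMap, lsum_map]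
  exact key []

@[simp] theorem cut_nil (H : Forest → Forest → M) : cut [] H = H [] [] := by
  simp [cut_eq]

/-! Sums over independent cuts, decompositions and shuffles commute. -/

theorem shuf_shuf_swap (x₁ y₁ x₂ y₂ : Forest) (F : Forest → Forest → M) :
    (shuf x₁ y₁ fun a₁ => shuf x₂ y₂ fun a₂ => F a₁ a₂) =
      shuf x₂ y₂ fun a₂ => shuf x₁ y₁ fun a₁ => F a₁ a₂ :=
  lsum_comm _ _ _

theorem shuf_decon_swap (x₁ y₁ w₂ : Forest) (F : Forest → Forest → Forest → M) :
    (shuf x₁ y₁ fun a₁ => decon w₂ fun a₂ c₂ => F a₁ a₂ c₂) =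
      decon w₂ fun a₂ c₂ => shuf x₁ y₁ fun a₁ => F a₁ a₂ c₂ :=
  lsum_comm _ _ _

theorem shuf_prune_swap (x₁ y₁ w₂ : Forest) (F : Forest → Forest → Forest → M) :
    (shuf x₁ y₁ fun a₁ => prune w₂ fun a₂ c₂ => F a₁ a₂ c₂) =
      prune w₂ fun a₂ c₂ => shuf x₁ y₁ fun a₁ => F a₁ a₂ c₂ :=
  lsum_comm _ _ _

theorem shuf_cut_swap (x₁ y₁ w₂ : Forest) (F : Forest → Forest → Forest → M) :
    (shuf x₁ y₁ fun a₁ => cut w₂ fun a₂ c₂ => F a₁ a₂ c₂) =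
      cut w₂ fun a₂ c₂ => shuf x₁ y₁ fun a₁ => F a₁ a₂ c₂ :=
  lsum_comm _ _ _

theorem decon_decon_swap (w₁ w₂ : Forest) (F : Forest → Forest → Forest → Forest → M) :
    (decon w₁ fun a₁ c₁ => decon w₂ fun a₂ c₂ => F a₁ c₁ a₂ c₂) =
      decon w₂ fun a₂ c₂ => decon w₁ fun a₁ c₁ => F a₁ c₁ a₂ c₂ :=
  lsum_comm _ _ _

theorem decon_prune_swap (w₁ w₂ : Forest) (F : Forest → Forest → Forest → Forest → M) :
    (decon w₁ fun a₁ c₁ => prune w₂ fun a₂ c₂ => F a₁ c₁ a₂ c₂) =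
      prune w₂ fun a₂ c₂ => decon w₁ fun a₁ c₁ => F a₁ c₁ a₂ c₂ :=
  lsum_comm _ _ _

theorem decon_cut_swap (w₁ w₂ : Forest) (F : Forest → Forest → Forest → Forest → M) :
    (decon w₁ fun a₁ c₁ => cut w₂ fun a₂ c₂ => F a₁ c₁ a₂ c₂) =
      cut w₂ fun a₂ c₂ => decon w₁ fun a₁ c₁ => F a₁ c₁ a₂ c₂ :=
  lsum_comm _ _ _

theorem prune_prune_swap (w₁ w₂ : Forest) (F : Forest → Forest → Forest → Forest → M) :
    (prune w₁ fun a₁ c₁ => prune w₂ fun a₂ c₂ => F a₁ c₁ a₂ c₂) =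
      prune w₂ fun a₂ c₂ => prune w₁ fun a₁ c₁ => F a₁ c₁ a₂ c₂ :=
  lsum_comm _ _ _

theorem prune_cut_swap (w₁ w₂ : Forest) (F : Forest → Forest → Forest → Forest → M) :
    (prune w₁ fun a₁ c₁ => cut w₂ fun a₂ c₂ => F a₁ c₁ a₂ c₂) =
      cut w₂ fun a₂ c₂ => prune w₁ fun a₁ c₁ => F a₁ c₁ a₂ c₂ :=
  lsum_comm _ _ _

end Cuts

/-! ### The coproducts given by cuts -/

section Cuts

variable {M : Type*} [AddCommMonoid M]

/-- The value `F c d` on the nonempty forest whose first tree has the branches `c` and whose other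
trees form `d`, and `0` on the empty forest. -/
def onCons : Forest → (Forest → Forest → M) → M
  | [], _ => 0
  | .node c :: d, F => F c d

@[simp] theorem onCons_nil (F : Forest → Forest → M) : onCons [] F = 0 := rfl
@[simp] theorem onCons_cons (c d : Forest) (F : Forest → Forest → M) :
    onCons (PTree.node c :: d) F = F c d := rfl

/-- A shuffle is empty, or starts with the first tree of one of the two forests. -/
theorem shuf_eq (x y : Forest) (f : Forest → M) :
    shuf x y f = onNil x (onNil y (f [])) +
      (onCons x fun c d => shuf d y fun w => f (PTree.node c :: w)) +
      onCons y fun c d => shuf x d fun w => f (PTree.node c :: w) := by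
  rcases x with _ | ⟨⟨c⟩, d⟩ <;> rcases y with _ | ⟨⟨c'⟩, d'⟩ <;> simp [shuf_cons_cons]

/-- The coproduct dual to left grafting is multiplicative for the shuffle product. -/
theorem shuf_prune (x y : Forest) (H : Forest → Forest → M) :
    (shuf x y fun w => prune w H) = prune x fun p q => prune y fun p' q' =>
      shuf p p' fun u => shuf q q' fun v => H u v := by
  -- the contribution of the shuffles whose first tree comes from `x`
  have half (c d y : Forest) (H : Forest → Forest → M)
      (ih : ∀ H : Forest → Forest → M, (shuf d y fun w => prune w H) =
        prune d fun p q => prune y fun p' q' => shuf p p' fun u => shuf q q' fun v => H u v) :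
      (shuf d y fun w => prune (PTree.node c :: w) H) =
        prune (PTree.node c :: d) fun p q => prune y fun p' q' => shuf p p' fun a =>
          onCons q fun r s => shuf s q' fun v => H a (PTree.node r :: v) := by
    simp only [prune_cons, onCons_cons]
    calc _ = cut c fun p r => shuf d y fun w => prune w fun p' q => shuf p p' fun a =>
            H a (PTree.node r :: q) := lsum_comm _ _ _
      _ = cut c fun p r => prune d fun p₁ q₁ => prune y fun p₂ q₂ =>
            shuf p₁ p₂ fun u => shuf q₁ q₂ fun v => shuf p u fun a =>
              H a (PTree.node r :: v) := by simp only [ih]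
      _ = cut c fun p r => prune d fun p₁ q₁ => prune y fun p₂ q₂ =>
            shuf p p₁ fun u => shuf u p₂ fun a => shuf q₁ q₂ fun v =>
              H a (PTree.node r :: v) := by
          refine cut_congr fun p r => prune_congr fun p₁ q₁ => prune_congr fun p₂ q₂ => ?_
          rw [shuf_assoc]
          exact shuf_congr fun u => lsum_comm _ _ _
      _ = _ := cut_congr fun p r => prune_congr fun p₁ q₁ => lsum_comm _ _ _
  induction x using forest_induction generalizing y H with
  | nil => simp
  | cons c d _ ihd =>
    induction y using forest_induction generalizing H with
    | nil => simp
    | cons c' d' _ ihd' =>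
      rw [shuf_cons_cons, half _ _ _ _ (ihd _), shuf_comm _ d', half _ _ _ _ fun H => ?_]
      · have e : (prune (PTree.node c' :: d') fun p q => prune (PTree.node c :: d) fun p' q' =>
            shuf p p' fun a => onCons q fun r s => shuf s q' fun v => H a (PTree.node r :: v)) =
            prune (PTree.node c :: d) fun p q => prune (PTree.node c' :: d') fun p' q' =>
              shuf p p' fun a => onCons q' fun r s => shuf q s fun v =>
                H a (PTree.node r :: v) := by
          rw [prune_prune_swap]
          refine prune_congr fun p q => prune_congr fun p' q' => ?_
          refine (shuf_comm _ _ _).trans (shuf_congr fun a => ?_)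
          rcases q' with _ | ⟨⟨r⟩, s⟩
          · rfl
          · exact shuf_comm _ _ _
        rw [e]
        simp only [← prune_add, ← shuf_add]
        simp only [prune_cons, onCons_cons, shuf_cons_cons]
      · rw [shuf_comm, ihd', prune_prune_swap]
        refine prune_congr fun p q => prune_congr fun p' q' => ?_
        rw [shuf_comm]
        exact shuf_congr fun a => shuf_comm _ _ _

/-- The coproduct `deltaN` is multiplicative for the shuffle product. -/
theorem shuf_cut (x y : Forest) (H : Forest → Forest → M) :
    (shuf x y fun w => cut w H) = cut x fun p q => cut y fun p' q' =>
      shuf p p' fun u => shuf q q' fun v => H u v := by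
  simp only [cut_eq, shuf_decon, shuf_prune]
  refine decon_congr fun x₁ x₂ => ?_
  calc _ = decon y fun y₁ y₂ => prune x₂ fun p q => prune y₂ fun p' q' =>
          shuf x₁ y₁ fun u => shuf p p' fun v => shuf u v fun a => shuf q q' fun b => H a b := by
        simp only [shuf_prune_swap]
        refine decon_congr fun y₁ y₂ => prune_congr fun p q => prune_congr fun p' q' =>
          shuf_congr fun u => shuf_congr fun v => shuf_shuf_swap _ _ _ _ _
    _ = prune x₂ fun p q => shuf x₁ p fun u => decon y fun y₁ y₂ => prune y₂ fun p' q' =>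
          shuf y₁ p' fun v => shuf u v fun a => shuf q q' fun b => H a b := by
        simp only [shuf_interchange x₁, ← shuf_prune_swap, decon_prune_swap, ← shuf_decon_swap]
    _ = _ := rfl

/-- The compatibility of left grafting with concatenation: a forest grafted onto a product is
distributed over the factors. -/
theorem prune_decon (w : Forest) (Φ : Forest → Forest → Forest → M) :
    (prune w fun p q => decon q fun q₁ q₂ => Φ p q₁ q₂) = decon w fun u v =>
      prune u fun p₁ q₁ => prune v fun p₂ q₂ => shuf p₁ p₂ fun p => Φ p q₁ q₂ := by
  induction w using forest_induction generalizing Φ with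
  | nil => simp
  | cons c d _ ih =>
    rw [decon_cons]
    have e : (prune (PTree.node c :: d) fun p q => decon q fun q₁ q₂ => Φ p q₁ q₂) =
        (prune (PTree.node c :: d) fun p q => Φ p [] q) +
        cut c fun p r => prune d fun p' q => decon q fun q₁ q₂ => shuf p p' fun a =>
          Φ a (PTree.node r :: q₁) q₂ := by
      simp only [prune_cons, decon_cons, shuf_add, prune_add, cut_add, shuf_decon_swap]
    rw [e]
    simp only [ih fun p q₁ q₂ => shuf _ p fun a => Φ a _ q₂, prune_nil, shuf_nil_left]
    simp only [prune_cons, decon_cut_swap, ← shuf_assoc, shuf_prune_swap]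

/-- The identity `u ▷ (v ▷ x) = (u ∗ v) ▷ x` implies the associativity of the Grossman–Larson
product `∗`; both are stated in dual form. -/
theorem cut_cut_of_prune_prune (w : Forest)
    (h : ∀ v, v <:+ w → ∀ Ψ : Forest → Forest → Forest → M,
      (prune v fun p q => prune q fun a b => Ψ p a b) =
        prune v fun x b => cut x fun p a => Ψ p a b) (Ψ : Forest → Forest → Forest → M) :
    (cut w fun p q => cut q fun a b => Ψ p a b) = cut w fun x b => cut x fun p a => Ψ p a b := by
  calc _ = decon w fun u v => prune v fun p q => decon q fun q₁ q₂ => prune q₂ fun a b =>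
          shuf u p fun x => shuf q₁ a fun y => Ψ x y b := by
        simp only [cut_eq, shuf_decon_swap, shuf_prune_swap]
    _ = decon w fun u v => decon v fun v₁ v₂ => prune v₁ fun p₁ q₁ => prune v₂ fun p₂ q₂ =>
          prune q₂ fun a b => shuf p₁ p₂ fun p => shuf u p fun x => shuf q₁ a fun y => Ψ x y b := by
        simp only [prune_decon, shuf_prune_swap]
    _ = decon w fun u v => decon v fun v₁ v₂ => prune v₁ fun p₁ q₁ => prune v₂ fun z b =>
          cut z fun p₂ a => shuf p₁ p₂ fun p => shuf u p fun x => shuf q₁ a fun y => Ψ x y b := by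
        refine decon_congr_of_append fun u v huv => decon_congr_of_append fun v₁ v₂ hv => ?_
        refine prune_congr fun p₁ q₁ => h _ ⟨u ++ v₁, by rw [List.append_assoc, hv, huv]⟩ _
    _ = decon w fun s v₂ => decon s fun u v₁ => prune v₁ fun p₁ q₁ => prune v₂ fun z b =>
          cut z fun p₂ a => shuf p₁ p₂ fun p => shuf u p fun x => shuf q₁ a fun y => Ψ x y b :=
        (decon_assoc _ _).symm
    _ = decon w fun s v₂ => prune v₂ fun z b => cut s fun p q => cut z fun p₂ a =>
          shuf p p₂ fun x => shuf q a fun y => Ψ x y b := by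
        refine decon_congr fun s v₂ => ?_
        rw [prune_cut_swap, cut_eq s]
        simp only [shuf_prune_swap, shuf_cut_swap, shuf_assoc]
    _ = _ := by simp only [cut_eq w, shuf_cut]

/-- The identity `u ▷ (v ▷ x) = (u ∗ v) ▷ x` in dual form. -/
theorem prune_prune (w : Forest) (Ψ : Forest → Forest → Forest → M) :
    (prune w fun p q => prune q fun a b => Ψ p a b) =
      prune w fun x b => cut x fun p a => Ψ p a b := by
  -- the induction hypothesis for the branches of a root is needed at all their suffixes
  suffices h : ∀ v, v <:+ w → ∀ Ψ : Forest → Forest → Forest → M,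
      (prune v fun p q => prune q fun a b => Ψ p a b) =
        prune v fun x b => cut x fun p a => Ψ p a b from h w (List.suffix_refl w) Ψ
  clear Ψ
  induction w using forest_induction with
  | nil =>
    intro v hv Ψ
    simp [List.suffix_nil.1 hv]
  | cons c d hc hd =>
    intro v hv Ψ
    rcases List.suffix_cons_iff.1 hv with rfl | hv
    · have hd := hd d (List.suffix_refl d)
      have hc := cut_cut_of_prune_prune c hc
      calc _ = cut c fun p r => prune d fun p' q => cut r fun a r' => prune q fun a' q' =>
              shuf p p' fun x => shuf a a' fun y => Ψ x y (PTree.node r' :: q') := by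
            simp only [prune_cons, shuf_cut_swap, shuf_prune_swap]
        _ = cut c fun p r => cut r fun a r' => prune d fun p' q => prune q fun a' q' =>
              shuf p p' fun x => shuf a a' fun y => Ψ x y (PTree.node r' :: q') := by
            simp only [prune_cut_swap]
        _ = cut c fun x r' => cut x fun p a => prune d fun y q' => cut y fun p' a' =>
              shuf p p' fun x => shuf a a' fun y => Ψ x y (PTree.node r' :: q') := by
            simp only [hd, hc]
        _ = _ := by
            simp only [prune_cons, shuf_cut, ← prune_cut_swap]
    · exact hd v hv Ψ

/-- The coproduct `deltaN` is coassociative. -/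
theorem cut_cut (w : Forest) (Ψ : Forest → Forest → Forest → M) :
    (cut w fun p q => cut q fun a b => Ψ p a b) = cut w fun x b => cut x fun p a => Ψ p a b :=
  cut_cut_of_prune_prune w (fun v _ => prune_prune v) Ψ

/-- The identity `x ▷ ∅ = ε(x) ∅` in dual form. -/
theorem prune_onNil_right (w : Forest) (f : Forest → M) :
    (prune w fun p q => onNil q (f p)) = onNil w (f []) := by
  rcases w with _ | ⟨⟨c⟩, d⟩
  · simp
  · simp [prune_cons, shuf_zero, prune_zero, cut_zero]

/-- The coefficient of the empty forest is a right counit for `cut`. -/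
theorem cut_onNil_right (w : Forest) (f : Forest → M) :
    (cut w fun p q => onNil q (f p)) = f w := by
  simp only [cut_eq]
  have (u v : Forest) : (prune v fun p q => shuf u p fun a => onNil q (f a)) = onNil v (f u) := by
    have h := prune_onNil_right v fun p => shuf u p f
    rw [shuf_nil_right] at h
    rw [← h]
    refine prune_congr fun p q => ?_
    cases q <;> simp [shuf_zero]
  simp only [this, decon_onNil_right]

/-- The identity `∅ ▷ x = x` in dual form. -/
theorem prune_onNil_left (w : Forest) (f : Forest → M) :
    (prune w fun p q => onNil p (f q)) = f w := by
  have hcut (c : Forest) (g : Forest → M)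
      (h : ∀ v, v <:+ c → ∀ f : Forest → M, (prune v fun p q => onNil p (f q)) = f v) :
      (cut c fun p q => onNil p (g q)) = g c := by
    rw [cut_eq, ← decon_onNil_left c g]
    refine decon_congr_of_append fun u v huv => ?_
    simp only [shuf_onNil]
    cases u with
    | nil => simpa using h v ⟨_, huv⟩ g
    | cons => simp [prune_zero]
  suffices h : ∀ v, v <:+ w → ∀ f : Forest → M, (prune v fun p q => onNil p (f q)) = f v from
    h w (List.suffix_refl w) f
  clear f
  induction w using forest_induction with
  | nil =>
    intro v hv f
    simp [List.suffix_nil.1 hv]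
  | cons c d hc hd =>
    intro v hv f
    rcases List.suffix_cons_iff.1 hv with rfl | hv
    · simp only [prune_cons, shuf_onNil]
      rw [← hcut c (fun r => f (PTree.node r :: d)) hc]
      refine cut_congr fun p r => ?_
      cases p with
      | nil => exact hd d (List.suffix_refl d) fun q => f (PTree.node r :: q)
      | cons => simp [prune_zero]
    · exact hd v hv f

/-- The coefficient of the empty forest is a left counit for `cut`. -/
theorem cut_onNil_left (w : Forest) (f : Forest → M) :
    (cut w fun p q => onNil p (f q)) = f w := by
  rw [cut_eq, ← decon_onNil_left w f]
  refine decon_congr fun u v => ?_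
  simp only [shuf_onNil]
  cases u with
  | nil => simpa using prune_onNil_left v f
  | cons => simp [prune_zero]

/-! ### The number of vertices -/

/-- The number of vertices of a forest. -/
def size (w : Forest) : ℕ := Fintype.card (forestVert w)

@[simp] theorem size_nil : size [] = 0 := rfl

theorem size_cons' (t : PTree) (w : Forest) :
    size (t :: w) = Fintype.card (PTree.Vert t) + size w :=
  Fintype.card_sum

theorem card_vert_node (c : Forest) : Fintype.card (PTree.Vert (.node c)) = size c + 1 :=
  Fintype.card_option

theorem size_cons (c d : Forest) : size (PTree.node c :: d) = size c + size d + 1 := by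
  rw [size_cons', card_vert_node]
  ring

theorem size_pos {w : Forest} (h : w ≠ []) : 0 < size w := by
  rcases w with _ | ⟨⟨c⟩, d⟩
  · exact absurd rfl h
  · rw [size_cons]; omega

theorem size_append (u v : Forest) : size (u ++ v) = size u + size v := by
  induction u with
  | nil => simp
  | cons t u ih => rw [List.cons_append, size_cons', size_cons', ih, add_assoc]

theorem shuf_congr_of_size {x y : Forest} {f g : Forest → M}
    (h : ∀ w, size w = size x + size y → f w = g w) : shuf x y f = shuf x y g := by
  induction x generalizing y f g with
  | nil => simpa using h y (by simp)
  | cons a x ihx =>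
    induction y generalizing f g with
    | nil => simpa using h (a :: x) (by simp)
    | cons b y ihy =>
      rw [shuf_cons_cons, shuf_cons_cons]
      congr 1
      · refine ihx fun w hw => h _ ?_
        rw [size_cons', size_cons' a, hw, add_assoc]
      · refine ihy fun w hw => h _ ?_
        rw [size_cons', size_cons' b, hw, add_left_comm]

/-- Cuts do not change the number of vertices, if this is known for the cuts that keep the roots. -/
theorem cut_congr_of_prune_congr {w : Forest}
    (hp : ∀ v, v <:+ w → ∀ {H H' : Forest → Forest → M},
      (∀ p q, size p + size q = size v → H p q = H' p q) → prune v H = prune v H')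
    {H H' : Forest → Forest → M}
    (h : ∀ p q, size p + size q = size w → H p q = H' p q) : cut w H = cut w H' := by
  rw [cut_eq, cut_eq]
  refine decon_congr_of_append fun u v huv => hp v ⟨_, huv⟩ fun p q hpq => ?_
  refine shuf_congr_of_size fun a ha => h _ _ ?_
  rw [ha, ← huv, size_append, ← hpq, add_assoc]

/-- Cuts do not change the number of vertices. -/
theorem prune_congr_of_size {w : Forest} {H H' : Forest → Forest → M}
    (h : ∀ p q, size p + size q = size w → H p q = H' p q) : prune w H = prune w H' := by
  suffices hs : ∀ v, v <:+ w → ∀ {H H' : Forest → Forest → M},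
      (∀ p q, size p + size q = size v → H p q = H' p q) → prune v H = prune v H' from
    hs w (List.suffix_refl w) h
  clear h H H'
  induction w using forest_induction with
  | nil =>
    intro v hv H H' h
    obtain rfl := List.suffix_nil.1 hv
    simpa using h [] [] rfl
  | cons c d hc hd =>
    intro v hv H H' h
    rcases List.suffix_cons_iff.1 hv with rfl | hv
    · rw [prune_cons, prune_cons]
      refine cut_congr_of_prune_congr hc fun p r hpr => hd d (List.suffix_refl d) fun p' q hq => ?_
      refine shuf_congr_of_size fun a ha => h _ _ ?_
      rw [size_cons, size_cons]
      omega
    · exact hd v hv h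

theorem decon_congr_of_size {w : Forest} {H H' : Forest → Forest → M}
    (h : ∀ u v, size u + size v = size w → H u v = H' u v) : decon w H = decon w H' :=
  decon_congr_of_append fun u v huv => h u v (by rw [← huv, size_append])

end Cuts

/-! ### Substitution of a series, and its transpose -/

section Coaction

variable {R : Type*} [CommRing R] {M : Type*} [AddCommGroup M] [Module R M]

/-- A function on forests, viewed as a formal series, is primitive if it is an infinitesimal
character of the shuffle algebra: it vanishes on the empty forest and on the shuffles of two
nonempty forests. -/
structure IsPrimitive (A : Forest → R) : Prop where
  nil : A [] = 0
  shuf : ∀ x y, shuf x y A = onNil x (A y) + onNil y (A x)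

variable (A : Forest → R)

mutual
/-- The coefficient of a forest in the series that arises from a tree when the series `A` is
substituted for each vertex. As the tree is the left grafting of its branches onto its root, this is
the grafting of the series of its branches onto `A`. -/
def seriesTree : PTree → Forest → R
  | .node c => fun w => prune w fun p q => seriesForest c p * A q
/-- The coefficient of a forest in the series that arises from a forest when the series `A` is
substituted for each vertex. -/
def seriesForest : List PTree → Forest → R
  | [] => fun w => onNil w 1
  | t :: u => fun w => decon w fun w₁ w₂ => seriesTree t w₁ * seriesForest u w₂
end

theorem seriesForest_nil (w : Forest) : seriesForest A [] w = onNil w 1 := by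
  simp [seriesForest]

theorem seriesForest_cons' (t : PTree) (u w : Forest) : seriesForest A (t :: u) w =
    decon w fun w₁ w₂ => seriesTree A t w₁ * seriesForest A u w₂ := by
  simp [seriesForest]

theorem seriesForest_cons (c d w : Forest) : seriesForest A (PTree.node c :: d) w =
    decon w fun w₁ w₂ =>
      (prune w₁ fun p q => seriesForest A c p * A q) * seriesForest A d w₂ := by
  simp [seriesForest, seriesTree]

/-- The forests of height at most `n`, viewed as binary trees; among them are all forests with at
most `n` vertices. -/
def forestsUpTo : ℕ → List Forest
  | 0 => [[]]
  | n + 1 => [] :: (forestsUpTo n).flatMap fun c => (forestsUpTo n).map fun d => PTree.node c :: d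

/-- The transpose of the substitution of `A`, restricted to finitely many forests. -/
def coactUpTo (n : ℕ) (f : Forest → M) (w : Forest) : M :=
  lsum (forestsUpTo n) fun u => seriesForest A u w • f u

/-- The transpose of the substitution of the series `A`: the sum over all forests `u` of
the coefficient of `w` in the substitution of `A` into `u`, times `f u`. If `A` has no constant
term, these coefficients vanish for the forests `u` with more vertices than `w`, so that the sum
over `forestsUpTo (size w)` is the full sum. -/
def coact (f : Forest → M) (w : Forest) : M := coactUpTo A (size w) f w

theorem onNil_smul (w : Forest) (m : M) : onNil w (1 : R) • m = onNil w m := by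
  cases w <;> simp

theorem decon_smul (w : Forest) (F : Forest → Forest → R) (m : M) :
    decon w F • m = decon w fun u v => F u v • m := lsum_smul _ _ _

theorem prune_smul (w : Forest) (F : Forest → Forest → R) (m : M) :
    prune w F • m = prune w fun u v => F u v • m := lsum_smul _ _ _

theorem smul_decon (w : Forest) (r : R) (F : Forest → Forest → M) :
    r • decon w F = decon w fun u v => r • F u v := smul_lsum _ _ _

theorem smul_prune (w : Forest) (r : R) (F : Forest → Forest → M) :
    r • prune w F = prune w fun u v => r • F u v := smul_lsum _ _ _

theorem smul_shuf (x y : Forest) (r : R) (F : Forest → M) :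
    r • shuf x y F = shuf x y fun u => r • F u := smul_lsum _ _ _

theorem smul_cut (w : Forest) (r : R) (F : Forest → Forest → M) :
    r • cut w F = cut w fun u v => r • F u v := smul_lsum _ _ _

theorem coactUpTo_succ (n : ℕ) (f : Forest → M) (w : Forest) :
    coactUpTo A (n + 1) f w = onNil w (f []) + decon w fun w₁ w₂ => prune w₁ fun p q =>
      A q • coactUpTo A n (fun c => coactUpTo A n (fun d => f (PTree.node c :: d)) w₂) p := by
  simp only [coactUpTo, forestsUpTo, lsum_cons, seriesForest_nil, onNil_smul, lsum_flatMap,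
    lsum_map, seriesForest_cons, decon_smul, smul_lsum]
  congr 1
  have h (c d : Forest) (m : M) : (decon w fun u v =>
      ((prune u fun p q => seriesForest A c p * A q) * seriesForest A d v) • m) =
      decon w fun u v => prune u fun p q =>
        A q • seriesForest A c p • seriesForest A d v • m := by
    refine decon_congr fun u v => ?_
    rw [mul_smul, prune_smul]
    refine prune_congr fun p q => ?_
    rw [mul_comm, mul_smul]
  simp only [h]
  simp only [decon, prune]
  simp only [lsum_comm (forestsUpTo n) (splits w)]
  refine lsum_congr fun s _ => ?_
  simp only [lsum_comm (forestsUpTo n) (innerCuts s.1)]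

variable {A}

/-- The sum is stable from `n = size w` on. -/
theorem coactUpTo_succ_eq (hA : A [] = 0) {n : ℕ} {w : Forest} (h : size w ≤ n)
    (f : Forest → M) : coactUpTo A (n + 1) f w = coactUpTo A n f w := by
  induction n generalizing f w with
  | zero =>
    have : w = [] := by
      by_contra hw
      have := size_pos hw
      omega
    subst this
    simp [coactUpTo_succ, hA]
    simp [coactUpTo, forestsUpTo, seriesForest_nil]
  | succ n ih =>
    rw [coactUpTo_succ, coactUpTo_succ A n]
    congr 1
    refine decon_congr_of_size fun u v huv => prune_congr_of_size fun p q hpq => ?_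
    -- a nonzero term cuts off fewer vertices than `w` has, as `A` has no constant term
    by_cases hq : q = []
    · simp [hq, hA]
    · have := size_pos hq
      rw [ih (by omega)]
      congr 2
      funext c
      rw [ih (by omega)]

theorem coactUpTo_eq (hA : A [] = 0) {n : ℕ} {w : Forest} (h : size w ≤ n)
    (f : Forest → M) : coactUpTo A n f w = coact A f w := by
  induction n, h using Nat.le_induction with
  | base => rfl
  | succ n h ih => rw [coactUpTo_succ_eq hA h, ih]

/-- The recursive description of the transposed substitution, according to the first tree of the
forest into which `A` is substituted. -/
theorem coact_eq (hA : A [] = 0) (f : Forest → M) (w : Forest) :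
    coact A f w = onNil w (f []) + decon w fun w₁ w₂ => prune w₁ fun p q =>
      A q • coact A (fun c => coact A (fun d => f (PTree.node c :: d)) w₂) p := by
  rw [coact, ← coactUpTo_succ_eq hA le_rfl, coactUpTo_succ]
  congr 1
  refine decon_congr_of_size fun u v huv => prune_congr_of_size fun p q hpq => ?_
  rw [coactUpTo_eq hA (by omega)]
  congr 2
  funext c
  rw [coactUpTo_eq hA (by omega)]

section Linear

variable {α : Type*} (w : Forest)

theorem coact_lsum (l : List α) (F : Forest → α → M) :
    coact A (fun u => lsum l (F u)) w = lsum l fun a => coact A (fun u => F u a) w := by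
  simp only [coact, coactUpTo, smul_lsum]
  exact lsum_comm _ _ _

theorem coact_add (f g : Forest → M) :
    coact A (fun u => f u + g u) w = coact A f w + coact A g w := by
  simp only [coact, coactUpTo, smul_add, lsum_add]

theorem coact_zero : coact A (fun _ => (0 : M)) w = 0 := by
  simp only [coact, coactUpTo, smul_zero, lsum_zero]

theorem coact_smul (r : R) (f : Forest → M) :
    coact A (fun u => r • f u) w = r • coact A f w := by
  simp only [coact, coactUpTo, smul_lsum, smul_comm r]

theorem coact_decon (v : Forest) (F : Forest → Forest → Forest → M) :
    coact A (fun u => decon v (F u)) w = decon v fun a b => coact A (fun u => F u a b) w :=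
  coact_lsum _ _ _

theorem coact_prune (v : Forest) (F : Forest → Forest → Forest → M) :
    coact A (fun u => prune v (F u)) w = prune v fun a b => coact A (fun u => F u a b) w :=
  coact_lsum _ _ _

theorem coact_cut (v : Forest) (F : Forest → Forest → Forest → M) :
    coact A (fun u => cut v (F u)) w = cut v fun a b => coact A (fun u => F u a b) w :=
  coact_lsum _ _ _

theorem coact_shuf (x y : Forest) (F : Forest → Forest → M) :
    coact A (fun u => shuf x y (F u)) w = shuf x y fun a => coact A (fun u => F u a) w :=
  coact_lsum _ _ _

theorem coact_swap (v : Forest) (F : Forest → Forest → M) :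
    coact A (fun u => coact A (F u) v) w = coact A (fun a => coact A (fun u => F u a) w) v := by
  simp only [coact, coactUpTo, smul_lsum, smul_comm (seriesForest A _ v)]
  exact lsum_comm _ _ _

end Linear

theorem coact_nil (f : Forest → M) : coact A f [] = f [] := by
  simp [coact, coactUpTo, forestsUpTo, seriesForest_nil]

theorem coact_onNil (hA : A [] = 0) (w : Forest) (m : M) :
    coact A (fun u => onNil u m) w = onNil w m := by
  rw [coact_eq hA]
  simp [coact_zero, prune_zero, decon_zero]

theorem coact_onCons (hA : A [] = 0) (F : Forest → Forest → M) (w : Forest) :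
    coact A (fun u => onCons u F) w = decon w fun w₁ w₂ => prune w₁ fun p q =>
      A q • coact A (fun c => coact A (fun d => F c d) w₂) p := by
  rw [coact_eq hA]
  simp

/-- In the recursive description of `coact`, two functions may be compared on forests with fewer
vertices only, since `A` has no constant term. -/
theorem decon_prune_smul_congr (hA : A [] = 0) {w : Forest} {F G : Forest → Forest → M}
    (h : ∀ p v, size p < size w → size v < size w → F p v = G p v) :
    (decon w fun u v => prune u fun p q => A q • F p v) =
      decon w fun u v => prune u fun p q => A q • G p v := by
  refine decon_congr_of_size fun u v huv => prune_congr_of_size fun p q hpq => ?_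
  by_cases hq : q = []
  · simp [hq, hA]
  · have := size_pos hq
    rw [h p v (by omega) (by omega)]

theorem coact_congr {w : Forest} {f g : Forest → M} (h : ∀ u, f u = g u) :
    coact A f w = coact A g w := by rw [funext h]

/-- The transposed substitution of a series commutes with deconcatenation: substitution is
multiplicative for the concatenation product. -/
theorem coact_decon_self (hA : A [] = 0) (w : Forest) (Φ : Forest → Forest → M) :
    coact A (fun u => decon u Φ) w =
      decon w fun w₁ w₂ => coact A (fun u => coact A (fun v => Φ u v) w₂) w₁ := by
  induction hn : size w using Nat.strong_induction_on generalizing w Φ with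
  | _ n ih =>
    subst hn
    -- the empty first part contributes `coact A (Φ []) w`, the others are handled by induction
    have h0 := coact_eq hA (Φ []) w
    have h1 : (decon w fun w₁ w₂ => prune w₁ fun p q => A q • coact A (fun c =>
        coact A (fun d => decon d fun x y => Φ (PTree.node c :: x) y) w₂) p) =
        decon w fun w₁ w₂ => prune w₁ fun p q => A q • decon w₂ fun x y => coact A (fun c =>
          coact A (fun d => coact A (fun v => Φ (PTree.node c :: d) v) y) x) p := by
      refine decon_prune_smul_congr hA fun p v _ hv => ?_
      simp only [← coact_decon]
      exact coact_congr fun c => ih _ hv _ _ rfl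
    rw [coact_eq hA]
    simp only [decon_nil, decon_cons, coact_add, smul_add, prune_add, decon_add]
    rw [h1, ← add_assoc, ← h0]
    simp only [fun w₁ w₂ => coact_eq hA (fun u => coact A (fun v => Φ u v) w₂) w₁, decon_add,
      decon_onNil_left]
    congr 1
    rw [decon_assoc]
    simp only [smul_decon, decon_prune_swap]

/-- Grafting onto a primitive series gives a primitive series. -/
theorem shuf_prune_smul (hA : IsPrimitive A) (x y : Forest) (g : Forest → M) :
    (shuf x y fun w => prune w fun p q => A q • g p) =
      onNil x (prune y fun p q => A q • g p) + onNil y (prune x fun p q => A q • g p) := by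
  have hs (p p' q q' : Forest) : (shuf p p' fun u => shuf q q' fun v => A v • g u) =
      onNil q (A q' • shuf p p' g) + onNil q' (A q • shuf p p' g) := by
    have (u : Forest) : (shuf q q' fun v => A v • g u) =
        onNil q (A q' • g u) + onNil q' (A q • g u) := by
      have h := congrArg (fun r : R => r • g u) (hA.shuf q q')
      simp only [add_smul] at h
      rw [shuf, lsum_smul] at h
      rw [shuf, h]
      cases q <;> cases q' <;> simp
    simp only [this, shuf_add]
    congr 1
    · cases q <;> simp [shuf, smul_lsum, lsum_zero]
    · cases q' <;> simp [shuf, smul_lsum, lsum_zero]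
  have hx (x y : Forest) : (prune x fun p q => prune y fun p' q' =>
      onNil q (A q' • shuf p p' g)) = onNil x (prune y fun p q => A q • g p) := by
    have (p q : Forest) : (prune y fun p' q' => onNil q (A q' • shuf p p' g)) =
        onNil q (prune y fun p' q' => A q' • shuf p p' g) := by
      cases q <;> simp [prune_zero]
    simp only [this, prune_onNil_right x fun p => prune y fun p' q' => A q' • shuf p p' g,
      shuf_nil_left]
  rw [shuf_prune]
  simp only [hs, prune_add]
  rw [hx, prune_prune_swap x y]
  simp only [fun p p' : Forest => shuf_comm p p' g]
  rw [hx]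

/-- The transposed substitution of a primitive series is multiplicative for the shuffle product:
substitution is compatible with the deshuffling coproduct. -/
theorem shuf_coact (hA : IsPrimitive A) (x y : Forest) (f : Forest → M) :
    shuf x y (coact A f) = coact A (fun u => coact A (fun v => shuf u v f) y) x := by
  induction hn : size x + size y using Nat.strong_induction_on generalizing x y f with
  | _ n ih =>
    subst hn
    -- by primitivity, the part of a shuffle that arises from the first tree of the forest into
    -- which `A` is substituted belongs entirely to `x` or entirely to `y`
    have hl : shuf x y (coact A f) = onNil x (onNil y (f [])) +
        ((decon y fun y₁ y₂ => prune y₁ fun p q => A q • coact A (fun c =>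
          coact A (fun u => coact A (fun v => shuf u v fun d => f (PTree.node c :: d)) y₂) x) p) +
        decon x fun x₁ x₂ => prune x₁ fun p q => A q • coact A (fun c =>
          coact A (fun u => coact A (fun v => shuf u v fun d => f (PTree.node c :: d)) y)
            x₂) p) := by
      rw [shuf_congr fun w => coact_eq hA.nil f w, shuf_add, shuf_onNil, shuf_decon]
      congr 1
      calc _ = decon x fun x₁ x₂ => decon y fun y₁ y₂ =>
              onNil x₁ (prune y₁ fun p q => A q • coact A (fun c =>
                shuf x₂ y₂ fun v => coact A (fun d => f (PTree.node c :: d)) v) p) +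
              onNil y₁ (prune x₁ fun p q => A q • coact A (fun c =>
                shuf x₂ y₂ fun v => coact A (fun d => f (PTree.node c :: d)) v) p) := by
            refine decon_congr fun x₁ x₂ => decon_congr fun y₁ y₂ => ?_
            rw [shuf_shuf_swap]
            simp only [shuf_prune_smul hA, shuf_add, coact_shuf, smul_shuf, ← shuf_prune_swap]
            congr 1
            · cases x₁ <;> simp [shuf_zero]
            · cases y₁ <;> simp [shuf_zero]
        _ = (decon y fun y₁ y₂ => prune y₁ fun p q => A q • coact A (fun c =>
                shuf x y₂ fun v => coact A (fun d => f (PTree.node c :: d)) v) p) +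
              decon x fun x₁ x₂ => prune x₁ fun p q => A q • coact A (fun c =>
                shuf x₂ y fun v => coact A (fun d => f (PTree.node c :: d)) v) p := by
            simp only [decon_add, decon_onNil_left]
            rw [decon_decon_swap]
            simp only [decon_onNil_left]
        _ = _ := by
            congr 1
            · refine decon_prune_smul_congr hA.nil fun p v _ hv => coact_congr fun c => ?_
              exact ih _ (by omega) _ _ _ rfl
            · refine decon_prune_smul_congr hA.nil fun p v _ hv => coact_congr fun c => ?_
              exact ih _ (by omega) _ _ _ rfl
    have h1 (u : Forest) (F : Forest → M) (w : Forest) :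
        coact A (fun v => onNil u (F v)) w = onNil u (coact A F w) := by
      cases u <;> simp [coact_zero]
    have h2 (u : Forest) (F : Forest → Forest → Forest → M) (w : Forest) :
        coact A (fun v => onCons u (F v)) w = onCons u fun c d => coact A (fun v => F v c d) w := by
      rcases u with _ | ⟨⟨c⟩, d⟩ <;> simp [coact_zero]
    rw [hl]
    simp only [fun u v => shuf_eq u v f, coact_add, h1, h2, coact_onNil hA.nil,
      coact_onCons hA.nil]
    simp only [coact_decon, coact_prune, coact_smul]
    rw [add_assoc, add_comm (decon y _)]
    congr 2
    refine decon_congr fun y₁ y₂ => prune_congr fun p q => ?_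
    rw [coact_swap]

/-- If substitution commutes with left grafting at all forests with at most as many vertices as
`w`, then it commutes with the Grossman–Larson product at `w`; both are stated in dual form. -/
theorem coact_cut_self_of (hA : IsPrimitive A) {w : Forest}
    (h : ∀ v, size v ≤ size w → ∀ H : Forest → Forest → M, coact A (fun u => prune u H) v =
      prune v fun p q => coact A (fun a => coact A (fun b => H a b) q) p)
    (H : Forest → Forest → M) : coact A (fun u => cut u H) w =
      cut w fun p q => coact A (fun a => coact A (fun b => H a b) q) p := by
  simp only [cut_eq]
  rw [coact_decon_self hA.nil]
  refine decon_congr_of_size fun u v huv => ?_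
  simp only [h v (by omega), coact_prune]
  refine prune_congr fun p q => ?_
  rw [shuf_coact hA]
  refine coact_congr fun a => coact_congr fun b => ?_
  exact coact_shuf _ _ _ _

/-- The transposed substitution of a primitive series commutes with the coproduct dual to left
grafting. -/
theorem coact_prune_self (hA : IsPrimitive A) (w : Forest) (H : Forest → Forest → M) :
    coact A (fun u => prune u H) w =
      prune w fun p q => coact A (fun a => coact A (fun b => H a b) q) p := by
  induction hn : size w using Nat.strong_induction_on generalizing w H with
  | _ n ih =>
    subst hn
    have hcut (p : Forest) (hp : size p < size w) (H : Forest → Forest → M) :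
        coact A (fun u => cut u H) p =
          cut p fun p q => coact A (fun a => coact A (fun b => H a b) q) p :=
      coact_cut_self_of hA (fun v hv H => ih _ (hv.trans_lt hp) _ _ rfl) H
    -- `p` is the part cut off, `r` consists of the remaining branches of the first root and `q` of
    -- what remains of the other trees
    let G (p r q : Forest) : M := coact A (fun a => coact A (fun c => coact A (fun d =>
      H a (PTree.node c :: d)) q) r) p
    calc _ = onNil w (H [] []) + decon w fun w₁ w₂ => prune w₁ fun x y => A y •
            cut x fun p r => prune w₂ fun p' q => shuf p p' fun a => G a r q := by
          rw [coact_eq hA.nil]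
          simp only [prune_nil, prune_cons]
          congr 1
          refine decon_prune_smul_congr hA.nil fun x v hx hv => ?_
          calc _ = coact A (fun c => cut c fun p r => prune v fun p' q =>
                  coact A (fun a => coact A (fun b => shuf p a fun a' =>
                    H a' (PTree.node r :: b)) q) p') x := by
                refine coact_congr fun c => ?_
                rw [coact_cut]
                exact cut_congr fun p r => ih _ hv _ _ rfl
            _ = _ := by
                rw [hcut x hx]
                simp only [coact_prune]
                refine cut_congr fun p r => prune_congr fun p' q => ?_
                rw [shuf_coact hA]
                refine coact_congr fun s => ?_
                rw [coact_swap]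
                simp only [coact_shuf]
      _ = onNil w (H [] []) + prune w fun p q => decon q fun q₁ q₂ => prune q₁ fun x y =>
            A y • G p x q₂ := by
          rw [prune_decon]
          congr 1
          refine decon_congr fun w₁ w₂ => ?_
          simp only [shuf_prune_swap, smul_cut, smul_prune, smul_shuf]
          rw [← prune_prune w₁ fun p x y => prune w₂ fun p' q => shuf p p' fun a =>
            A y • G a x q]
          simp only [prune_prune_swap w₂]
      _ = _ := by
          simp only [fun a q => coact_eq hA.nil (fun b => H a b) q, coact_add, coact_decon,
            coact_prune, coact_smul, prune_add, G]
          congr 1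
          have h (q : Forest) (p : Forest) : coact A (fun a => onNil q (H a [])) p =
              onNil q (coact A (fun a => H a []) p) := by
            cases q <;> simp [coact_zero]
          simp only [h, prune_onNil_right w fun p => coact A (fun a => H a []) p, coact_nil]

/-- The transposed substitution of a primitive series commutes with the coproduct `deltaN`. -/
theorem coact_cut_self (hA : IsPrimitive A) (w : Forest) (H : Forest → Forest → M) :
    coact A (fun u => cut u H) w =
      cut w fun p q => coact A (fun a => coact A (fun b => H a b) q) p :=
  coact_cut_self_of hA (fun v _ => coact_prune_self hA v) H

end Coaction

/-! ### Composition and degree of substitutions -/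

section Series

variable {R : Type*} [CommRing R] {A : Forest → R}

theorem decon_mul (w : Forest) (F : Forest → Forest → R) (r : R) :
    decon w F * r = decon w fun u v => F u v * r := decon_smul w F r

theorem mul_decon (w : Forest) (r : R) (F : Forest → Forest → R) :
    r * decon w F = decon w fun u v => r * F u v := smul_decon w r F

theorem mul_prune (w : Forest) (r : R) (F : Forest → Forest → R) :
    r * prune w F = prune w fun u v => r * F u v := smul_prune w r F

theorem coact_mul_left (w : Forest) (r : R) (f : Forest → R) :
    coact A (fun u => r * f u) w = r * coact A f w := coact_smul w r f

theorem coact_mul_right (w : Forest) (r : R) (f : Forest → R) :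
    coact A (fun u => f u * r) w = coact A f w * r := by
  simp only [mul_comm _ r, coact_mul_left]

/-- Substituting `B` and then `A` is the same as substituting the result of substituting `A`
into `B`. -/
theorem coact_seriesForest (hA : IsPrimitive A) (B : Forest → R) (u w : Forest) :
    coact A (seriesForest B u) w = seriesForest (coact A B) u w := by
  induction u using forest_induction generalizing w with
  | nil =>
    simp only [coact_congr (seriesForest_nil B), coact_onNil hA.nil, seriesForest_nil]
  | cons c d hc hd =>
    simp only [coact_congr (seriesForest_cons B c d), coact_decon_self hA.nil, seriesForest_cons,
      coact_mul_left, coact_mul_right, coact_prune_self hA, hd, hc]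

theorem map_seriesForest {S : Type*} [CommRing S] (φ : R →+* S) (u w : Forest) :
    φ (seriesForest A u w) = seriesForest (fun v => φ (A v)) u w := by
  have hd (w : Forest) (F : Forest → Forest → R) :
      φ (decon w F) = decon w fun u v => φ (F u v) := map_lsum φ _ _
  have hp (w : Forest) (F : Forest → Forest → R) :
      φ (prune w F) = prune w fun u v => φ (F u v) := map_lsum φ _ _
  induction u using forest_induction generalizing w with
  | nil => rw [seriesForest_nil, seriesForest_nil]; cases w <;> simp
  | cons c d hc hd' => simp only [seriesForest_cons, hd, map_mul, hp, hc, hd']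

theorem seriesForest_congr {A' : Forest → R} {u w : Forest}
    (h : ∀ v, size v ≤ size w → A v = A' v) : seriesForest A u w = seriesForest A' u w := by
  induction u using forest_induction generalizing w with
  | nil => rw [seriesForest_nil, seriesForest_nil]
  | cons c d hc hd =>
    rw [seriesForest_cons, seriesForest_cons]
    refine decon_congr_of_size fun w₁ w₂ hw => ?_
    rw [hd fun v hv => h v (by omega)]
    congr 1
    refine prune_congr_of_size fun p q hpq => ?_
    rw [h q (by omega), hc fun v hv => h v (by omega)]

/-- Substituting a series without constant term does not decrease the number of vertices. -/
theorem seriesForest_eq_zero (hA : A [] = 0) {u w : Forest} (h : size w < size u) :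
    seriesForest A u w = 0 := by
  induction u using forest_induction generalizing w with
  | nil => simp at h
  | cons c d hc hd =>
    rw [seriesForest_cons, ← decon_zero w]
    rw [size_cons] at h
    refine decon_congr_of_size fun w₁ w₂ hw => ?_
    by_cases h2 : size w₂ < size d
    · rw [hd h2, mul_zero]
    · rw [← prune_zero w₁, prune_congr_of_size fun p q hpq => ?_, prune_zero, zero_mul]
      by_cases hq : q = []
      · rw [hq, hA, mul_zero]
      · have := size_pos hq
        rw [hc (by omega), zero_mul]

theorem seriesForest_append (u v w : Forest) : seriesForest A (u ++ v) w =
    decon w fun w₁ w₂ => seriesForest A u w₁ * seriesForest A v w₂ := by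
  induction u generalizing w with
  | nil =>
    rw [List.nil_append, ← decon_onNil_left w (seriesForest A v)]
    refine decon_congr fun w₁ w₂ => ?_
    rw [seriesForest_nil]
    cases w₁ <;> simp
  | cons t u ih =>
    simp only [List.cons_append, seriesForest_cons', ih, decon_mul, mul_decon, mul_assoc]
    exact (decon_assoc w fun a b c =>
      seriesTree A t a * (seriesForest A u b * seriesForest A v c)).symm

theorem seriesForest_singleton (t : PTree) (w : Forest) :
    seriesForest A [t] w = seriesTree A t w := by
  rw [seriesForest_cons', ← decon_onNil_right w (seriesTree A t)]
  refine decon_congr fun w₁ w₂ => ?_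
  rw [seriesForest_nil]
  cases w₂ <;> simp

theorem mem_forestsUpTo {n : ℕ} {u : Forest} (h : size u ≤ n) : u ∈ forestsUpTo n := by
  induction n generalizing u with
  | zero =>
    by_cases hu : u = []
    · simp [hu, forestsUpTo]
    · have := size_pos hu
      omega
  | succ n ih =>
    rcases u with _ | ⟨⟨c⟩, d⟩
    · simp [forestsUpTo]
    · rw [size_cons] at h
      simp only [forestsUpTo, List.mem_cons, List.mem_flatMap, List.mem_map]
      exact Or.inr ⟨c, ih (by omega), d, ih (by omega), rfl⟩

theorem nodup_forestsUpTo (n : ℕ) : (forestsUpTo n).Nodup := by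
  induction n with
  | zero => simp [forestsUpTo]
  | succ n ih =>
    rw [forestsUpTo, List.nodup_cons]
    refine ⟨by simp, List.nodup_flatMap.2 ⟨fun c _ => ih.map fun d d' h => by simpa using h, ?_⟩⟩
    refine ih.imp fun {c c'} hne => ?_
    simp only [Function.onFun, List.disjoint_left, List.mem_map]
    rintro _ ⟨d, _, rfl⟩ ⟨d', _, h⟩
    simp only [List.cons.injEq, PTree.node.injEq] at h
    exact hne h.1.symm

/-- The product of primitive series fails to be primitive by a symmetric term. -/
theorem shuf_mul_of_isPrimitive {X Y : Forest → R} (hX : IsPrimitive X) (hY : IsPrimitive Y)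
    (x y : Forest) : (shuf x y fun w => decon w fun u v => X u * Y v) =
      onNil x (decon y fun u v => X u * Y v) + onNil y (decon x fun u v => X u * Y v) +
        (X x * Y y + X y * Y x) := by
  have hs (x₁ y₁ x₂ y₂ : Forest) : (shuf x₁ y₁ fun u => shuf x₂ y₂ fun v => X u * Y v) =
      onNil x₁ (onNil x₂ (X y₁ * Y y₂)) + onNil x₁ (onNil y₂ (X y₁ * Y x₂)) +
        (onNil y₁ (onNil x₂ (X x₁ * Y y₂)) + onNil y₁ (onNil y₂ (X x₁ * Y x₂))) := by
    have h1 (u : Forest) : (shuf x₂ y₂ fun v => X u * Y v) = X u * shuf x₂ y₂ Y :=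
      (smul_lsum (X u) _ Y).symm
    have h2 (r : R) : (shuf x₁ y₁ fun u => X u * r) = shuf x₁ y₁ X * r := (lsum_smul _ X r).symm
    simp only [h1, h2, hX.shuf, hY.shuf]
    cases x₁ <;> cases y₁ <;> cases x₂ <;> cases y₂ <;> simp [hX.nil, hY.nil]
  rw [shuf_decon]
  simp only [hs, decon_add]
  rw [decon_decon_swap x y fun x₁ x₂ y₁ y₂ => onNil x₁ (onNil x₂ (X y₁ * Y y₂)),
    decon_decon_swap x y fun x₁ x₂ y₁ y₂ => onNil x₁ (onNil y₂ (X y₁ * Y x₂))]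
  simp only [decon_onNil_left, decon_onNil_right]
  have h1 : (decon y fun c d => onNil x (X c * Y d)) = onNil x (decon y fun u v => X u * Y v) := by
    cases x <;> simp [decon_zero]
  have h3 : (decon x fun a b => onNil y (X a * Y b)) = onNil y (decon x fun u v => X u * Y v) := by
    cases y <;> simp [decon_zero]
  rw [h1, h3]
  ring

end Series

/-! ### Coefficients of products and graftings -/

section Coefficients

variable (K : Type*) [Field K]

variable {K} in
theorem forestSpan_induction {P : OF K → Prop} (x : OF K) (hw : ∀ w, P (forest K w))
    (hadd : ∀ x y, P x → P y → P (x + y)) (hsmul : ∀ (c : K) x, P x → P (c • x)) : P x := by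
  have hx : x ∈ Submodule.span K (Set.range (forestBasis K)) := by
    rw [Module.Basis.span_eq]; trivial
  induction hx using Submodule.span_induction with
  | mem x hx => obtain ⟨w, rfl⟩ := hx; rw [forestBasis_apply]; exact hw w
  | zero => simpa using hsmul 0 _ (hw [])
  | add x y _ _ hx hy => exact hadd x y hx hy
  | smul c x _ hx => exact hsmul c x hx

open Classical in
theorem coeff_forest (u w : Forest) : coeff K w (forest K u) = if u = w then 1 else 0 := by
  rw [coeff, ← forestBasis_apply, Module.Basis.coord_apply, Module.Basis.repr_self,
    Finsupp.single_apply]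

variable {K} in
theorem ext_coeff {x y : OF K} (h : ∀ w, coeff K w x = coeff K w y) : x = y :=
  (forestBasis K).ext_elem h

theorem coeff_one (w : Forest) : coeff K w (1 : OF K) = onNil w 1 := by
  rw [← forest_nil, coeff_forest]
  cases w <;> simp

open Classical in
theorem coeff_forest_cons_cons (s t : PTree) (u w : Forest) :
    coeff K (t :: w) (forest K (s :: u)) = if s = t then coeff K w (forest K u) else 0 := by
  simp only [coeff_forest, List.cons.injEq]
  split_ifs <;> simp_all

theorem coeff_nil_forest_cons (t : PTree) (u : Forest) :
    coeff K [] (forest K (t :: u)) = 0 := by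
  rw [coeff_forest, if_neg (by simp)]

theorem coeff_cons_forest_cons (c d c' d' : Forest) :
    coeff K (PTree.node c' :: d') (forest K (PTree.node c :: d)) =
      coeff K c' (forest K c) * coeff K d' (forest K d) := by
  simp only [coeff_forest, List.cons.injEq, PTree.node.injEq]
  split_ifs <;> simp_all

variable {K}

theorem coeff_mul (w : Forest) (x y : OF K) :
    coeff K w (x * y) = decon w fun u v => coeff K u x * coeff K v y := by
  induction x using forestSpan_induction with
  | hw u =>
    induction y using forestSpan_induction with
    | hw v =>
      rw [← forest_append]
      induction u generalizing w with
      | nil =>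
        rw [List.nil_append, ← decon_onNil_left w fun v' => coeff K v' (forest K v)]
        refine decon_congr fun u v => ?_
        rw [forest_nil, coeff_one]
        cases u <;> simp
      | cons s u ih =>
        cases w with
        | nil => simp [coeff_nil_forest_cons]
        | cons t w =>
          simp only [List.cons_append, decon_cons, coeff_forest_cons_cons, ih,
            coeff_nil_forest_cons, zero_mul, zero_add]
          split_ifs <;> simp [decon_zero]
    | hadd y z hy hz => simp only [mul_add, map_add, hy, hz, decon_add]
    | hsmul c y hy =>
      simp only [mul_smul_comm, map_smul, hy, smul_eq_mul, mul_decon, mul_left_comm]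
  | hadd x z hx hz => simp only [add_mul, map_add, hx, hz, decon_add]
  | hsmul c x hx =>
    simp only [smul_mul_assoc, map_smul, hx, smul_eq_mul, mul_decon, mul_assoc]

/-- The shuffle product is dual to the deshuffling coproduct. -/
theorem shuf_coeff_forest (u x y : Forest) : (shuf x y fun w => coeff K w (forest K u)) =
    lsum (deshuffles u) fun a => coeff K x (forest K a.1) * coeff K y (forest K a.2) := by
  induction u generalizing x y with
  | nil =>
    simp only [forest_nil, coeff_one, shuf_onNil, deshuffles, lsum_cons, lsum_nil]
    cases x <;> cases y <;> simp
  | cons a u ih =>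
    simp only [deshuffles, lsum_flatMap, lsum_cons, lsum_nil, add_zero, lsum_add]
    cases x with
    | nil =>
      cases y with
      | nil => simp [coeff_nil_forest_cons, lsum_zero]
      | cons c y =>
        have h := ih [] y
        rw [shuf_nil_left] at h
        simp only [shuf_nil_left, coeff_nil_forest_cons, coeff_forest_cons_cons, zero_mul,
          lsum_zero, zero_add, h]
        split_ifs <;> simp [lsum_zero]
    | cons b x =>
      cases y with
      | nil =>
        have h := ih x []
        rw [shuf_nil_right] at h
        simp only [shuf_nil_right, coeff_nil_forest_cons, coeff_forest_cons_cons, mul_zero,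
          lsum_zero, add_zero, h]
        split_ifs <;> simp [lsum_zero]
      | cons c y =>
        simp only [shuf_cons_cons, coeff_forest_cons_cons]
        congr 1
        · split_ifs
          · exact ih _ _
          · simp [lsum_zero, shuf_zero]
        · split_ifs
          · exact ih _ _
          · simp [lsum_zero, shuf_zero]

variable (K) in
/-- The linear map that attaches the trees of a forest to a new root. -/
def bPlus : OF K →ₗ[K] OF K := (forestBasis K).constr K fun w => forest K [PTree.node w]

theorem bPlus_forest (w : Forest) : bPlus K (forest K w) = forest K [PTree.node w] := by
  rw [bPlus, ← forestBasis_apply, Module.Basis.constr_basis]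

theorem coeff_nil_bPlus (x : OF K) : coeff K [] (bPlus K x) = 0 := by
  induction x using forestSpan_induction with
  | hw u => rw [bPlus_forest, coeff_nil_forest_cons]
  | hadd x y hx hy => simp [hx, hy]
  | hsmul c x hx => simp [hx]

theorem coeff_cons_bPlus_mul (c d : Forest) (x y : OF K) :
    coeff K (PTree.node c :: d) (bPlus K x * y) = coeff K c x * coeff K d y := by
  induction x using forestSpan_induction with
  | hw u =>
    induction y using forestSpan_induction with
    | hw v => rw [bPlus_forest, ← forest_append, List.singleton_append, coeff_cons_forest_cons]
    | hadd x y hx hy => simp only [mul_add, map_add, hx, hy]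
    | hsmul r x hx => simp only [mul_smul_comm, map_smul, hx, smul_eq_mul, mul_left_comm]
  | hadd x y hx hy => simp only [add_mul, map_add, hx, hy]
  | hsmul r x hx => simp only [smul_mul_assoc, map_smul, hx, smul_eq_mul, mul_assoc]

/-- Left grafting of a forest onto a nonempty one, in terms of the branches of the first root. -/
theorem graft_forest_cons (u c d : Forest) :
    graft K (forest K u) (forest K (PTree.node c :: d)) = lsum (deshuffles u) fun a =>
      bPlus K (lsum (deshuffles a.1) fun e => forest K e.1 * graft K (forest K e.2) (forest K c)) *
        graft K (forest K a.2) (forest K d) := by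
  rw [graft_forest, forestSum_cons]
  refine lsum_congr fun a _ => ?_
  have hl (m : List Forest) : forestSum K m = lsum m (forest K) := rfl
  rw [graft_forest]
  congr 1
  simp only [hl, lsum_map, graftTree, lsum_flatMap, map_lsum]
  refine lsum_congr fun e _ => ?_
  rw [graft_forest, hl, ← LinearMap.mulLeft_apply (R := K), map_lsum, map_lsum]
  refine lsum_congr fun d _ => ?_
  rw [LinearMap.mulLeft_apply, ← forest_append, bPlus_forest]

/-- Left grafting is dual to `prune`. -/
theorem coeff_graft (w : Forest) (x y : OF K) :
    coeff K w (graft K x y) = prune w fun p q => coeff K p x * coeff K q y := by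
  induction x using forestSpan_induction with
  | hw u =>
    induction y using forestSpan_induction with
    | hw v =>
      induction v using forest_induction generalizing u w with
      | nil =>
        have h := prune_onNil_right w fun p => coeff K p (forest K u)
        have (p q : Forest) : coeff K p (forest K u) * coeff K q (forest K []) =
            onNil q (coeff K p (forest K u)) := by
          rw [forest_nil, coeff_one]
          cases q <;> simp
        simp only [this, h]
        rw [graft_forest]
        cases u <;> cases w <;>
          simp [graftForest, forestSum, forest_nil, coeff_one, coeff_nil_forest_cons]
      | cons c d hc hd =>
        rw [graft_forest_cons, map_lsum]
        rcases w with _ | ⟨⟨c'⟩, d'⟩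
        · simp [coeff_mul, coeff_nil_bPlus, coeff_nil_forest_cons, lsum_zero]
        · simp only [coeff_cons_bPlus_mul, prune_cons, coeff_cons_forest_cons]
          have hs (f : Forest) (p p' : Forest) (r : K) :
              (shuf p p' fun a => coeff K a (forest K f) * r) = lsum (deshuffles f) fun a =>
                coeff K p (forest K a.1) * coeff K p' (forest K a.2) * r := by
            rw [← lsum_mul, ← shuf_coeff_forest, shuf, shuf, lsum_mul]
          have hcut (f : Forest) : (lsum (deshuffles f) fun e => coeff K c'
              (forest K e.1 * graft K (forest K e.2) (forest K c))) =
              cut c' fun p r => coeff K p (forest K f) * coeff K r (forest K c) := by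
            simp only [coeff_mul, hc, cut_eq, hs, mul_prune]
            simp only [decon, prune, lsum_comm (deshuffles f), mul_assoc]
          simp only [map_lsum, hcut, hd, hs]
          simp only [cut, prune, lsum_mul, mul_lsum, lsum_comm (deshuffles u)]
          rw [lsum_comm (innerCuts d')]
          simp only [mul_mul_mul_comm]
    | hadd y z hy hz => simp only [mul_add, map_add, hy, hz, prune_add]
    | hsmul c y hy =>
      simp only [map_smul, hy, smul_eq_mul, mul_prune, mul_left_comm]
  | hadd x z hx hz => simp only [add_mul, map_add, LinearMap.add_apply, hx, hz, prune_add]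
  | hsmul c x hx =>
    simp only [map_smul, LinearMap.smul_apply, hx, smul_eq_mul, mul_prune, mul_assoc]

/-- Lie polynomials are primitive for the deshuffling coproduct. -/
theorem isPrimitive_coeff {x : OF K} (hx : x ∈ LiePT K) :
    IsPrimitive fun w => coeff K w x := by
  induction hx using LieSubalgebra.lieSpan_induction with
  | mem y hy =>
    obtain ⟨t, rfl⟩ := hy
    refine ⟨coeff_nil_forest_cons K _ _, fun x y => ?_⟩
    rw [shuf_coeff_forest]
    simp only [deshuffles, List.flatMap_cons, List.flatMap_nil, List.append_nil, lsum_cons,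
      lsum_nil, forest_nil, coeff_one]
    cases x <;> cases y <;> simp [coeff_nil_forest_cons]
  | zero => exact ⟨by simp, fun x y => by simp [shuf_zero]⟩
  | add a b _ _ ha hb =>
    refine ⟨by simp [ha.nil, hb.nil], fun x y => ?_⟩
    simp only [map_add, shuf_add, ha.shuf, hb.shuf]
    cases x <;> cases y <;> simp [ha.nil, hb.nil]
  | smul c a _ ha =>
    refine ⟨by simp [ha.nil], fun x y => ?_⟩
    simp only [map_smul, ← smul_shuf, ha.shuf]
    cases x <;> cases y <;> simp [ha.nil]
  | lie a b _ _ ha hb =>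
    refine ⟨by simp [Ring.lie_def, coeff_mul, ha.nil, hb.nil], fun x y => ?_⟩
    have e1 := shuf_mul_of_isPrimitive ha hb x y
    have e2 := shuf_mul_of_isPrimitive hb ha x y
    simp only [← coeff_mul] at e1 e2
    have e : (shuf x y fun w => coeff K w ⁅a, b⁆) =
        (shuf x y fun w => coeff K w (a * b)) - shuf x y fun w => coeff K w (b * a) := by
      rw [eq_sub_iff_add_eq, ← shuf_add]
      refine shuf_congr fun w => ?_
      rw [Ring.lie_def, map_sub, sub_add_cancel]
    rw [e, e1, e2, Ring.lie_def]
    cases x <;> cases y <;> simp <;> ring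

end Coefficients

/-! ### Substitution is homogeneous -/

section Degree

variable {K : Type*} [Field K]

/-- All forests with a nonzero coefficient have `n` vertices. -/
def IsHomogeneous (n : ℕ) (x : OF K) : Prop := ∀ w, size w ≠ n → coeff K w x = 0

theorem isHomogeneous_forest (u : Forest) : IsHomogeneous (size u) (forest K u) := by
  intro w hw
  rw [coeff_forest, if_neg]
  rintro rfl
  exact hw rfl

theorem isHomogeneous_one : IsHomogeneous 0 (1 : OF K) := isHomogeneous_forest []

theorem IsHomogeneous.mul {m n : ℕ} {x y : OF K} (hx : IsHomogeneous m x)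
    (hy : IsHomogeneous n y) : IsHomogeneous (m + n) (x * y) := by
  intro w hw
  rw [coeff_mul, ← decon_zero w]
  refine decon_congr_of_size fun u v huv => ?_
  by_cases hu : size u = m
  · rw [hy v (by omega), mul_zero]
  · rw [hx u hu, zero_mul]

theorem IsHomogeneous.graft {m n : ℕ} {x y : OF K} (hx : IsHomogeneous m x)
    (hy : IsHomogeneous n y) : IsHomogeneous (m + n) (graft K x y) := by
  intro w hw
  rw [coeff_graft, ← prune_zero w]
  refine prune_congr_of_size fun u v huv => ?_
  by_cases hu : size u = m
  · rw [hy v (by omega), mul_zero]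
  · rw [hx u hu, zero_mul]

theorem IsHomogeneous.lie {m n : ℕ} {x y : OF K} (hx : IsHomogeneous m x)
    (hy : IsHomogeneous n y) : IsHomogeneous (m + n) ⁅x, y⁆ := by
  intro w hw
  rw [Ring.lie_def, map_sub, hx.mul hy w hw, hy.mul hx w (by omega), sub_zero]

/-! The types of vertices of trees, nonempty forests and brackets unfold to `Option` and sum types,
and so do their `Fintype` instances. -/

theorem sum_vert_node {M : Type*} [AddCommMonoid M] (c : Forest)
    (g : PTree.Vert (.node c) → M) : ∑ v, g v = g none + ∑ v : forestVert c, g (some v) :=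
  Fintype.sum_option g

theorem sum_forestVert_cons {M : Type*} [AddCommMonoid M] (t : PTree) (d : Forest)
    (g : forestVert (t :: d) → M) :
    ∑ v, g v = ∑ v : PTree.Vert t, g (.inl v) + ∑ v : forestVert d, g (.inr v) :=
  Fintype.sum_sum_type g

theorem sum_vert_mul {M : Type*} [AddCommMonoid M] (x y : LieMonomial)
    (g : LieMonomial.Vert (.mul x y) → M) :
    ∑ v, g v = ∑ v : LieMonomial.Vert x, g (.inl v) + ∑ v : LieMonomial.Vert y, g (.inr v) :=
  Fintype.sum_sum_type g

theorem prod_vert_node {M : Type*} [CommMonoid M] (c : Forest)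
    (g : PTree.Vert (.node c) → M) : ∏ v, g v = g none * ∏ v : forestVert c, g (some v) :=
  Fintype.prod_option g

theorem prod_forestVert_cons {M : Type*} [CommMonoid M] (t : PTree) (d : Forest)
    (g : forestVert (t :: d) → M) :
    ∏ v, g v = (∏ v : PTree.Vert t, g (.inl v)) * ∏ v : forestVert d, g (.inr v) :=
  Fintype.prod_sum_type g

theorem prod_vert_mul {M : Type*} [CommMonoid M] (x y : LieMonomial)
    (g : LieMonomial.Vert (.mul x y) → M) :
    ∏ v, g v = (∏ v : LieMonomial.Vert x, g (.inl v)) * ∏ v : LieMonomial.Vert y, g (.inr v) :=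
  Fintype.prod_sum_type g

theorem isHomogeneous_substTree_node {c : Forest}
    (hc : ∀ (f : forestVert c → OF K) (d : forestVert c → ℕ),
      (∀ v, IsHomogeneous (d v) (f v)) → IsHomogeneous (∑ v, d v) (substForest c f))
    (f : PTree.Vert (.node c) → OF K) (d : PTree.Vert (.node c) → ℕ)
    (h : ∀ v, IsHomogeneous (d v) (f v)) :
    IsHomogeneous (∑ v, d v) (substTree (.node c) f) := by
  rw [sum_vert_node, add_comm]
  exact (hc _ _ fun v => h (some v)).graft (h none)

theorem isHomogeneous_substForest (u : Forest) (f : forestVert u → OF K) (d : forestVert u → ℕ)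
    (h : ∀ v, IsHomogeneous (d v) (f v)) : IsHomogeneous (∑ v, d v) (substForest u f) := by
  induction u using forest_induction with
  | nil => exact isHomogeneous_one
  | cons c e hc he =>
    rw [sum_forestVert_cons]
    exact (isHomogeneous_substTree_node hc _ _ fun v => h (.inl v)).mul
      (he _ _ fun v => h (.inr v))

theorem isHomogeneous_subst (m : LieMonomial) (f : LieMonomial.Vert m → OF K)
    (d : LieMonomial.Vert m → ℕ) (h : ∀ v, IsHomogeneous (d v) (f v)) :
    IsHomogeneous (∑ v, d v) (LieMonomial.subst m f) := by
  induction m with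
  | of t =>
    cases t with
    | node c => exact isHomogeneous_substTree_node (isHomogeneous_substForest c) f d h
  | mul x y hx hy =>
    rw [sum_vert_mul]
    exact (hx _ _ fun v => h (.inl v)).lie (hy _ _ fun v => h (.inr v))

theorem isHomogeneous_eval (m : LieMonomial) :
    IsHomogeneous (Fintype.card (LieMonomial.Vert m)) (LieMonomial.eval K m : OF K) := by
  induction m with
  | of t =>
    have : size [t] = Fintype.card (LieMonomial.Vert (.of t)) := by
      rw [size_cons', size_nil, add_zero]; rfl
    rw [← this]
    exact isHomogeneous_forest [t]
  | mul x y hx hy =>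
    have : Fintype.card (LieMonomial.Vert (.mul x y)) =
      Fintype.card (LieMonomial.Vert x) + Fintype.card (LieMonomial.Vert y) := Fintype.card_sum
    rw [this]
    exact hx.lie hy

theorem card_vert_pos (m : LieMonomial) : 0 < Fintype.card (LieMonomial.Vert m) := by
  induction m with
  | of t =>
    cases t with
    | node c => exact (Nat.succ_pos _).trans_eq (card_vert_node c).symm
  | mul x y hx hy => exact (Nat.add_pos_left hx _).trans_eq Fintype.card_sum.symm

/-- A bracket has more vertices than each of its two sides, and there are finitely many trees with a
given number of vertices. -/
theorem finite_lieMonomial_card_le (n : ℕ) :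
    {m : LieMonomial | Fintype.card (LieMonomial.Vert m) ≤ n}.Finite := by
  induction n with
  | zero =>
    convert Set.finite_empty
    ext m
    simpa using (card_vert_pos m).ne'
  | succ n ih =>
    have ht : {t : PTree | [t] ∈ forestsUpTo (n + 1)}.Finite :=
      (List.finite_toSet _).preimage fun s _ t _ h => by simpa using h
    refine ((ht.image FreeMagma.of).union (ih.image2 FreeMagma.mul ih)).subset ?_
    rintro (t | ⟨x, y⟩) h
    · refine Or.inl ⟨t, mem_forestsUpTo ?_, rfl⟩
      rw [size_cons', size_nil, add_zero]
      exact h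
    · have hx := card_vert_pos x
      have hy := card_vert_pos y
      have h' : Fintype.card (LieMonomial.Vert x) + Fintype.card (LieMonomial.Vert y) ≤ n + 1 :=
        Fintype.card_sum.symm.trans_le h
      exact Or.inr ⟨x, by simp only [Set.mem_ofPred_eq]; omega, y,
        by simp only [Set.mem_ofPred_eq]; omega, rfl⟩

end Degree

/-! ### Sums over labelled substitutions -/

section Labelled

variable {K : Type*} [Field K]

theorem lsum_finset_sum {γ α M : Type*} [AddCommMonoid M] (l : List γ) (s : Finset α)
    (F : γ → α → M) : (lsum l fun c => ∑ a ∈ s, F c a) = ∑ a ∈ s, lsum l fun c => F c a := by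
  induction l with
  | nil => simp
  | cons c l ih => simp [ih, Finset.sum_add_distrib]

/-- A bilinear expression in two linear combinations, expanded over all pairs of terms. -/
theorem lsum_sum_mul_sum {γ α α' R : Type*} [Fintype α] [Fintype α'] [CommRing R] [Algebra K R]
    (l : List γ) (X : α → γ → K) (Y : α' → γ → K) (x : α → R) (y : α' → R) :
    (lsum l fun c => (∑ a, X a c • x a) * ∑ a', Y a' c • y a') =
      ∑ p : α × α', (lsum l fun c => X p.1 c * Y p.2 c) • (x p.1 * y p.2) := by
  simp only [Finset.sum_mul_sum, ← Finset.sum_product', Finset.univ_product_univ]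
  rw [lsum_finset_sum]
  refine Finset.sum_congr rfl fun p _ => ?_
  rw [lsum_smul]
  refine lsum_congr fun c _ => ?_
  rw [smul_mul_smul_comm]

/-- A function on the vertices of a tree is a function on the vertices of its branches together
with a value at the root. -/
def vertNodeArrowEquiv (c : Forest) (J : Type*) :
    (PTree.Vert (.node c) → J) ≃ (forestVert c → J) × J :=
  (Equiv.piOptionEquivProd (α := forestVert c) (β := fun _ => J)).trans (Equiv.prodComm _ _)

/-- A function on the vertices of a nonempty forest, restricted to its first tree and to the other
trees. -/
def forestVertConsArrowEquiv (t : PTree) (d : Forest) (J : Type*) :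
    (forestVert (t :: d) → J) ≃ (PTree.Vert t → J) × (forestVert d → J) :=
  Equiv.sumArrowEquivProdArrow _ _ _

/-- A function on the vertices of a bracket, restricted to the two sides of the bracket. -/
def vertMulArrowEquiv (x y : LieMonomial) (J : Type*) :
    (LieMonomial.Vert (.mul x y) → J) ≃ (LieMonomial.Vert x → J) × (LieMonomial.Vert y → J) :=
  Equiv.sumArrowEquivProdArrow _ _ _

variable {J R : Type*} [Fintype J] [CommRing R] [Algebra K R] (g : J → OF K) (r : J → R)

/-- The generic linear combination of the elements `g j`, with coefficients `r j`, as a series. -/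
def combination (w : Forest) : R := ∑ j, coeff K w (g j) • r j

open Classical in
theorem seriesTree_node_combination {c : Forest}
    (hc : ∀ w, seriesForest (combination g r) c w = ∑ f : forestVert c → J,
      coeff K w (substForest c fun v => g (f v)) • ∏ v, r (f v)) (w : Forest) :
    seriesTree (combination g r) (.node c) w = ∑ f : PTree.Vert (.node c) → J,
      coeff K w (substTree (.node c) fun v => g (f v)) • ∏ v, r (f v) := by
  rw [seriesTree]
  simp only [hc, combination, prune]
  rw [lsum_sum_mul_sum]
  symm
  refine Fintype.sum_equiv (M := R) (vertNodeArrowEquiv c J) _ _ fun f => ?_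
  rw [prod_vert_node, mul_comm, substTree, coeff_graft]
  rfl

open Classical in
/-- The coefficients of the series obtained by substituting a generic linear combination into a
forest are sums over all substitutions. -/
theorem seriesForest_combination (u w : Forest) :
    seriesForest (combination g r) u w = ∑ f : forestVert u → J,
      coeff K w (substForest u fun v => g (f v)) • ∏ v, r (f v) := by
  induction u using forest_induction generalizing w with
  | nil =>
    have : IsEmpty (forestVert []) := inferInstanceAs (IsEmpty Empty)
    rw [seriesForest_nil, Fintype.sum_unique, substForest, coeff_one, Fintype.prod_empty]
    cases w <;> simp
  | cons c d hc hd =>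
    rw [seriesForest_cons']
    simp only [seriesTree_node_combination g r hc, hd, decon]
    rw [lsum_sum_mul_sum]
    symm
    refine Fintype.sum_equiv (M := R) (forestVertConsArrowEquiv (.node c) d J) _ _ fun f => ?_
    rw [prod_forestVert_cons, substForest, coeff_mul]
    rfl

/-- The coefficient of a forest in the series that arises from a Lie monomial when the series `A`
is substituted for each vertex. -/
def seriesMonomial {R : Type*} [CommRing R] (A : Forest → R) : LieMonomial → Forest → R
  | .of t => seriesTree A t
  | .mul x y => fun w => (decon w fun u v => seriesMonomial A x u * seriesMonomial A y v) -
      decon w fun u v => seriesMonomial A y u * seriesMonomial A x v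

open Classical in
theorem seriesMonomial_combination (m : LieMonomial) (w : Forest) :
    seriesMonomial (combination g r) m w = ∑ f : LieMonomial.Vert m → J,
      coeff K w (LieMonomial.subst m fun v => g (f v)) • ∏ v, r (f v) := by
  induction m generalizing w with
  | of t =>
    cases t with
    | node c => exact seriesTree_node_combination g r (seriesForest_combination g r c) w
  | mul x y hx hy =>
    rw [seriesMonomial]
    simp only [hx, hy, decon]
    rw [lsum_sum_mul_sum, lsum_sum_mul_sum]
    rw [← (Equiv.prodComm (LieMonomial.Vert x → J) (LieMonomial.Vert y → J)).sum_comp,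
      ← Finset.sum_sub_distrib]
    symm
    refine Fintype.sum_equiv (M := R) (vertMulArrowEquiv x y J) _ _ fun f => ?_
    rw [prod_vert_mul, LieMonomial.subst, Ring.lie_def, map_sub, sub_smul, coeff_mul, coeff_mul]
    congr 2
    exact mul_comm _ _

open Classical in
/-- Averaging over all labellings of a set by `1, …, n` gives the sum over all functions on the
set: each of the `n!` labellings contributes the same sum. -/
theorem sum_labellings [CharZero K] {V ι N : Type*} [Fintype V] [AddCommGroup N] [Module K N]
    (I : Finset ι) (G : (V → ι) → N) (hG : ∀ f, G f ≠ 0 → ∀ v, f v ∈ I) :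
    ∑ σ : V ≃ Fin (Fintype.card V), ∑ᶠ k : Fin (Fintype.card V) → ι,
      (((Nat.factorial (Fintype.card V) : ℕ) : K)⁻¹ • G fun v => k (σ v)) =
      ∑ f : V → I, G fun v => f v := by
  have h (σ : V ≃ Fin (Fintype.card V)) : (∑ᶠ k : Fin (Fintype.card V) → ι,
      (((Nat.factorial (Fintype.card V) : ℕ) : K)⁻¹ • G fun v => k (σ v))) =
      ((Nat.factorial (Fintype.card V) : ℕ) : K)⁻¹ • ∑ f : V → I, G fun v => f v := by
    rw [← smul_finsum]
    congr 1
    rw [← finsum_comp_equiv (σ.arrowCongr (Equiv.refl ι))]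
    simp only [Equiv.arrowCongr_apply, Equiv.coe_refl, Function.comp_apply, id_eq,
      Equiv.symm_apply_apply]
    let e : (V → I) ↪ (V → ι) := ⟨fun f v => f v, fun f f' h => by
      funext v
      exact Subtype.ext (congrFun h v)⟩
    rw [finsum_eq_sum_of_support_subset (s := Finset.univ.map e), Finset.sum_map]
    · rfl
    · intro f hf
      simp only [Finset.coe_map, Finset.coe_univ, Set.image_univ]
      exact ⟨fun v => ⟨f v, hG f hf v⟩, rfl⟩
  simp only [h, Finset.sum_const, Finset.card_univ]
  rw [Fintype.card_equiv (Fintype.equivFin V), ← Nat.cast_smul_eq_nsmul K, smul_smul,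
    mul_inv_cancel₀ (Nat.cast_ne_zero.2 (Nat.factorial_ne_zero _)), one_smul]

end Labelled

/-! ### The generic Lie polynomial -/

section Generic

variable {K : Type*} [Field K] {ι : Type*} {β : ι → LieMonomial}
  {b : Module.Basis ι K (LiePT K)}

theorem isHomogeneous_basis (hb : ∀ i, b i = LieMonomial.eval K (β i)) (i : ι) :
    IsHomogeneous (Fintype.card (LieMonomial.Vert (β i))) (b i : OF K) := by
  rw [hb]
  exact isHomogeneous_eval _

theorem finite_basis_card_le (hb : ∀ i, b i = LieMonomial.eval K (β i)) (n : ℕ) :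
    {i | Fintype.card (LieMonomial.Vert (β i)) ≤ n}.Finite := by
  refine (finite_lieMonomial_card_le n).preimage fun i _ j _ h => b.injective ?_
  rw [hb, hb, h]

/-- The indices of the basis elements with at most `n` vertices. -/
def basisUpTo (hb : ∀ i, b i = LieMonomial.eval K (β i)) (n : ℕ) : Finset ι :=
  (finite_basis_card_le hb n).toFinset

theorem mem_basisUpTo (hb : ∀ i, b i = LieMonomial.eval K (β i)) {n : ℕ} {i : ι} :
    i ∈ basisUpTo hb n ↔ Fintype.card (LieMonomial.Vert (β i)) ≤ n := by
  simp [basisUpTo]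

theorem mem_basisUpTo_of_coeff (hb : ∀ i, b i = LieMonomial.eval K (β i)) {n : ℕ} {i : ι}
    {w : Forest} (hw : size w ≤ n) (h : coeff K w (b i : OF K) ≠ 0) : i ∈ basisUpTo hb n := by
  rw [mem_basisUpTo]
  by_contra hi
  exact h (isHomogeneous_basis hb i w (by omega))

variable (b) in
/-- The generic Lie polynomial `∑ i, b i ⊗ b i`, as a series with coefficients in `Q`. -/
def generic (w : Forest) : Q K :=
  ∑ᶠ i, coeff K w (b i : OF K) • SymmetricAlgebra.ι K (LiePT K) (b i)

theorem generic_eq_sum (hb : ∀ i, b i = LieMonomial.eval K (β i)) {n : ℕ} {w : Forest}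
    (hw : size w ≤ n) : generic b w =
      ∑ i ∈ basisUpTo hb n, coeff K w (b i : OF K) • SymmetricAlgebra.ι K (LiePT K) (b i) := by
  refine finsum_eq_sum_of_support_subset _ fun i hi => ?_
  refine mem_basisUpTo_of_coeff hb hw fun h => hi ?_
  simp only [h, zero_smul]

theorem generic_eq_combination (hb : ∀ i, b i = LieMonomial.eval K (β i)) {n : ℕ} {w : Forest}
    (hw : size w ≤ n) : generic b w = combination (fun i : basisUpTo hb n => (b i : OF K))
      (fun i => SymmetricAlgebra.ι K (LiePT K) (b i)) w := by
  rw [generic_eq_sum hb hw, combination]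
  exact (Finset.sum_coe_sort (basisUpTo hb n) fun i =>
    coeff K w (b i : OF K) • SymmetricAlgebra.ι K (LiePT K) (b i)).symm

theorem isPrimitive_combination {J R : Type*} [Fintype J] [CommRing R] [Algebra K R]
    (g : J → OF K) (hg : ∀ j, g j ∈ LiePT K) (r : J → R) : IsPrimitive (combination g r) := by
  refine ⟨by simp [combination, (isPrimitive_coeff (hg _)).nil], fun x y => ?_⟩
  have h (j : J) := (isPrimitive_coeff (hg j)).shuf x y
  have e : shuf x y (combination g r) = ∑ j, (shuf x y fun w => coeff K w (g j)) • r j := by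
    simp only [shuf, lsum_smul, ← lsum_finset_sum]
    rfl
  rw [e]
  simp only [h, add_smul, Finset.sum_add_distrib]
  cases x <;> cases y <;> simp [combination]

/-- Only finitely many basis elements matter for forests of bounded size, so the primitivity of
finite combinations suffices. -/
theorem isPrimitive_generic (hb : ∀ i, b i = LieMonomial.eval K (β i)) :
    IsPrimitive (generic b) := by
  have h (n : ℕ) := isPrimitive_combination (fun i : basisUpTo hb n => (b i : OF K))
    (fun i => (b i).2) (fun i => SymmetricAlgebra.ι K (LiePT K) (b i))
  refine ⟨(generic_eq_combination hb le_rfl).trans (h 0).nil, fun x y => ?_⟩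
  rw [shuf_congr_of_size fun w hw => generic_eq_combination hb hw.le, (h _).shuf,
    ← generic_eq_combination hb (Nat.le_add_right _ _),
    ← generic_eq_combination hb (Nat.le_add_left _ _)]

/-- The basis is adapted to the grading by the number of vertices. -/
theorem repr_eq_zero_of_isHomogeneous (hb : ∀ i, b i = LieMonomial.eval K (β i)) {n : ℕ}
    {x : LiePT K} (hx : IsHomogeneous n (x : OF K)) {i : ι}
    (hi : Fintype.card (LieMonomial.Vert (β i)) ≠ n) : b.repr x i = 0 := by
  classical
  -- the projection to the component with `n` vertices
  let P : LiePT K →ₗ[K] LiePT K :=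
    b.constr K fun j => if Fintype.card (LieMonomial.Vert (β j)) = n then b j else 0
  have hP (w : Forest) (hw : size w = n) :
      coeff K w ∘ₗ (LiePT K).toSubmodule.subtype ∘ₗ P =
        coeff K w ∘ₗ (LiePT K).toSubmodule.subtype := by
    refine b.ext fun j => ?_
    simp only [P, LinearMap.comp_apply, Module.Basis.constr_basis]
    split_ifs with hj
    · rfl
    · rw [map_zero, map_zero]
      exact (isHomogeneous_basis hb j w (by omega)).symm
  have hP' (w : Forest) (hw : size w ≠ n) :
      coeff K w ∘ₗ (LiePT K).toSubmodule.subtype ∘ₗ P = 0 := by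
    refine b.ext fun j => ?_
    simp only [P, LinearMap.comp_apply, Module.Basis.constr_basis]
    split_ifs with hj
    · exact isHomogeneous_basis hb j w (by omega)
    · simp
  have hr : b.coord i ∘ₗ P = 0 := by
    refine b.ext fun j => ?_
    simp only [P, LinearMap.comp_apply, Module.Basis.constr_basis]
    split_ifs with hj
    · rw [Module.Basis.coord_apply, Module.Basis.repr_self, Finsupp.single_eq_of_ne]
      · rfl
      · rintro rfl
        exact hi hj
    · simp
  have hx' : P x = x := by
    refine Subtype.ext (ext_coeff fun w => ?_)
    by_cases hw : size w = n
    · exact LinearMap.congr_fun (hP w hw) x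
    · exact (LinearMap.congr_fun (hP' w hw) x).trans (hx w hw).symm
  rw [← hx']
  exact LinearMap.congr_fun hr x

/-- The coefficients of the generic Lie polynomial span `Lie(PT)`: a linear map on `Q` is determined
on `Lie(PT)` by its values there. -/
theorem eq_of_forall_generic (hb : ∀ i, b i = LieMonomial.eval K (β i)) {V : Type*}
    [AddCommGroup V] [Module K V] {F G : Q K →ₗ[K] V}
    (h : ∀ w, F (generic b w) = G (generic b w)) (i : ι) :
    F (SymmetricAlgebra.ι K (LiePT K) (b i)) = G (SymmetricAlgebra.ι K (LiePT K) (b i)) := by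
  classical
  rw [← sub_eq_zero, ← Module.forall_dual_apply_eq_zero_iff K]
  intro φ
  let l : ι → K := fun j => φ ((F - G) (SymmetricAlgebra.ι K (LiePT K) (b j)))
  set n := Fintype.card (LieMonomial.Vert (β i)) with hn
  have hl (w : Forest) (hw : size w ≤ n) :
      ∑ j ∈ basisUpTo hb n, coeff K w (b j : OF K) * l j = 0 := by
    have := congrArg φ (sub_eq_zero.2 (h w))
    rw [← LinearMap.sub_apply, generic_eq_sum hb hw] at this
    simpa [l, map_sum] using this
  -- the combination of the basis elements of degree `n` with coefficients `l j` vanishes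
  let y : LiePT K := ∑ j ∈ (basisUpTo hb n).filter
    (fun j => Fintype.card (LieMonomial.Vert (β j)) = n), l j • b j
  have hy : y = 0 := by
    refine Subtype.ext (ext_coeff fun w => ?_)
    have e : coeff K w (y : OF K) = ∑ j ∈ (basisUpTo hb n).filter
        (fun j => Fintype.card (LieMonomial.Vert (β j)) = n), l j * coeff K w (b j : OF K) := by
      change (coeff K w ∘ₗ (LiePT K).toSubmodule.subtype) y = _
      rw [map_sum]
      refine Finset.sum_congr rfl fun j _ => ?_
      rw [map_smul]
      rfl
    rw [e]
    refine Eq.trans ?_ (map_zero (coeff K w)).symm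
    by_cases hw : size w = n
    · rw [← hl w hw.le, Finset.sum_filter]
      refine Finset.sum_congr rfl fun j _ => ?_
      split_ifs with hj
      · exact mul_comm _ _
      · rw [isHomogeneous_basis hb j w (by omega), zero_mul]
    · refine Finset.sum_eq_zero fun j hj => ?_
      rw [isHomogeneous_basis hb j w (by rw [(Finset.mem_filter.1 hj).2]; exact hw), mul_zero]
  exact linearIndependent_iff'.1 b.linearIndependent _ _ hy i
    (Finset.mem_filter.2 ⟨(mem_basisUpTo hb).2 le_rfl, rfl⟩)

/-! ### The coaction and the coproduct of `Q` in terms of series -/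

theorem le_of_mem_sum {V : Type*} [Fintype V] (d : V → ℕ) {n : ℕ} (h : ∑ v, d v ≤ n) (v : V) :
    d v ≤ n := (Finset.single_le_sum (fun _ _ => Nat.zero_le _) (Finset.mem_univ v)).trans h

open Classical in
theorem finsum_eq_lsum {M : Type*} [AddCommMonoid M] {n : ℕ} {F : Forest → M}
    (h : ∀ u, n < size u → F u = 0) : ∑ᶠ u, F u = lsum (forestsUpTo n) F := by
  rw [finsum_eq_sum_of_support_subset (s := (forestsUpTo n).toFinset), lsum,
    List.sum_toFinset _ (nodup_forestsUpTo n)]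
  intro u hu
  simp only [List.coe_toFinset, Set.mem_ofPred_eq]
  refine mem_forestsUpTo (not_lt.1 fun hlt => hu (h u hlt))

open Classical in
/-- The coaction is the transpose of the substitution of the generic Lie polynomial. -/
theorem rho_forest [CharZero K] (hb : ∀ i, b i = LieMonomial.eval K (β i)) (w : Forest) :
    rho b (forest K w) = coact (generic b) (fun u => (1 : Q K) ⊗ₜ[K] forest K u) w := by
  rw [rho, ← forestBasis_apply, Module.Basis.constr_basis, rhoForest, coact, coactUpTo]
  have key (u : Forest) : (∑ σ : forestVert u ≃ Fin (Fintype.card (forestVert u)),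
      ∑ᶠ k : Fin (Fintype.card (forestVert u)) → ι,
        (((Nat.factorial (Fintype.card (forestVert u)) : ℕ) : K)⁻¹ *
          coeff K w (substForest u fun v => (b (k (σ v)) : OF K))) •
        ((∏ l, SymmetricAlgebra.ι K (LiePT K) (b (k l))) ⊗ₜ[K] forest K u)) =
      seriesForest (generic b) u w • ((1 : Q K) ⊗ₜ[K] forest K u) := by
    let G (f : forestVert u → ι) : Q K ⊗[K] OF K :=
      coeff K w (substForest u fun v => (b (f v) : OF K)) •
        ((∏ v, SymmetricAlgebra.ι K (LiePT K) (b (f v))) ⊗ₜ[K] forest K u)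
    have hG (f : forestVert u → ι) (hf : G f ≠ 0) (v : forestVert u) :
        f v ∈ basisUpTo hb (size w) := by
      rw [mem_basisUpTo]
      refine le_of_mem_sum (fun v => Fintype.card (LieMonomial.Vert (β (f v)))) (not_lt.1 ?_) v
      intro hlt
      refine hf ?_
      simp only [G]
      rw [isHomogeneous_substForest u _ _ (fun v => isHomogeneous_basis hb (f v)) w hlt.ne,
        zero_smul]
    have hs := sum_labellings (K := K) (basisUpTo hb (size w)) G hG
    have h1 (σ : forestVert u ≃ Fin (Fintype.card (forestVert u)))
        (k : Fin (Fintype.card (forestVert u)) → ι) :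
        ∏ v, SymmetricAlgebra.ι K (LiePT K) (b (k (σ v))) =
          ∏ l, SymmetricAlgebra.ι K (LiePT K) (b (k l)) :=
      Equiv.prod_comp σ fun l => SymmetricAlgebra.ι K (LiePT K) (b (k l))
    simp only [G, h1, smul_smul] at hs
    refine hs.trans ?_
    rw [seriesForest_congr fun v hv => generic_eq_combination hb hv, seriesForest_combination,
      TensorProduct.smul_tmul', smul_eq_mul, mul_one, TensorProduct.sum_tmul]
    refine Finset.sum_congr rfl fun f _ => ?_
    rw [TensorProduct.smul_tmul']
  simp only [key]
  refine finsum_eq_lsum fun u hu => ?_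
  rw [seriesForest_eq_zero (isPrimitive_generic hb).nil hu, zero_smul]

/-- The series obtained by substituting `A` into a linear combination of forests. The sum over
`forestsUpTo (size w)` is the full sum if `A` has no constant term. -/
def seriesLin {R : Type*} [CommRing R] [Algebra K R] (A : Forest → R) (x : OF K)
    (w : Forest) : R :=
  lsum (forestsUpTo (size w)) fun u => coeff K u x • seriesForest A u w

theorem lsum_coeff_forest_smul {M : Type*} [AddCommGroup M] [Module K M] {n : ℕ} {u : Forest}
    (hu : size u ≤ n) (f : Forest → M) :
    (lsum (forestsUpTo n) fun v => coeff K v (forest K u) • f v) = f u := by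
  classical
  rw [lsum, ← List.sum_toFinset _ (nodup_forestsUpTo n), Finset.sum_eq_single u]
  · rw [coeff_forest, if_pos rfl, one_smul]
  · intro v _ hv
    rw [coeff_forest, if_neg hv.symm, zero_smul]
  · intro h
    exact absurd (List.mem_toFinset.2 (mem_forestsUpTo hu)) h

theorem coeff_forest_comm (u v : Forest) : coeff K v (forest K u) = coeff K u (forest K v) := by
  classical
  rw [coeff_forest, coeff_forest]
  simp only [eq_comm]

section SeriesLin

variable {R : Type*} [CommRing R] [Algebra K R] {A : Forest → R}

theorem seriesLin_forest (hA : A [] = 0) (u w : Forest) :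
    seriesLin A (forest K u) w = seriesForest A u w := by
  by_cases h : size u ≤ size w
  · exact lsum_coeff_forest_smul h fun u => seriesForest A u w
  · rw [seriesForest_eq_zero hA (not_le.1 h), seriesLin, ← lsum_zero (forestsUpTo (size w))]
    refine lsum_congr fun v _ => ?_
    rw [coeff_forest]
    split_ifs with huv
    · rw [← huv, seriesForest_eq_zero hA (not_le.1 h), smul_zero]
    · rw [zero_smul]

theorem seriesLin_add (x y : OF K) (w : Forest) :
    seriesLin A (x + y) w = seriesLin A x w + seriesLin A y w := by
  simp only [seriesLin, map_add, add_smul, lsum_add]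

theorem seriesLin_smul (c : K) (x : OF K) (w : Forest) :
    seriesLin A (c • x) w = c • seriesLin A x w := by
  simp only [seriesLin, map_smul, smul_lsum, smul_eq_mul, mul_smul]

theorem seriesLin_mul (hA : A [] = 0) (x y : OF K) (w : Forest) :
    seriesLin A (x * y) w = decon w fun u v => seriesLin A x u * seriesLin A y v := by
  induction x using forestSpan_induction with
  | hw u =>
    induction y using forestSpan_induction with
    | hw v =>
      rw [← forest_append]
      simp only [seriesLin_forest hA, seriesForest_append]
    | hadd y z hy hz => simp only [mul_add, seriesLin_add, hy, hz, decon_add]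
    | hsmul c y hy =>
      simp only [mul_smul_comm, seriesLin_smul, hy]
      exact smul_lsum _ _ _
  | hadd x z hx hz => simp only [add_mul, seriesLin_add, hx, hz, decon_add]
  | hsmul c x hx =>
    simp only [smul_mul_assoc, seriesLin_smul, hx]
    exact smul_lsum _ _ _

/-- Substitution into a formal Lie monomial agrees with substitution into its expansion. -/
theorem seriesLin_eval (hA : A [] = 0) (m : LieMonomial) (w : Forest) :
    seriesLin A (LieMonomial.eval K m : OF K) w = seriesMonomial A m w := by
  induction m generalizing w with
  | of t => exact (seriesLin_forest hA [t] w).trans (seriesForest_singleton t w)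
  | mul x y hx hy =>
    have e : (LieMonomial.eval K (.mul x y) : OF K) =
        (LieMonomial.eval K x : OF K) * (LieMonomial.eval K y : OF K) +
          (-1 : K) • ((LieMonomial.eval K y : OF K) * (LieMonomial.eval K x : OF K)) := by
      rw [neg_one_smul, ← sub_eq_add_neg]
      rfl
    rw [e, seriesLin_add, seriesLin_smul, seriesLin_mul hA, seriesLin_mul hA, neg_one_smul,
      ← sub_eq_add_neg]
    simp only [hx, hy, seriesMonomial]

theorem seriesMonomial_congr {A' : Forest → R} {m : LieMonomial} {w : Forest}
    (h : ∀ v, size v ≤ size w → A v = A' v) : seriesMonomial A m w = seriesMonomial A' m w := by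
  induction m generalizing w with
  | of t =>
    simp only [seriesMonomial, ← seriesForest_singleton]
    exact seriesForest_congr h
  | mul x y hx hy =>
    simp only [seriesMonomial]
    congr 1
    all_goals
      refine decon_congr_of_size fun u v huv => ?_
      rw [hx fun z hz => h z (by omega), hy fun z hz => h z (by omega)]

end SeriesLin

/-- The expansion of a Lie polynomial in the basis, at the coefficient of one forest: only basis
elements with at most as many vertices contribute. -/
theorem sum_coeff_mul_repr (hb : ∀ i, b i = LieMonomial.eval K (β i)) {n : ℕ} {w : Forest}
    (hw : size w ≤ n) (x : LiePT K) :
    ∑ i ∈ basisUpTo hb n, coeff K w (b i : OF K) * b.repr x i = coeff K w (x : OF K) := by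
  classical
  have h : ∑ i ∈ basisUpTo hb n, coeff K w (b i : OF K) • b.coord i =
      coeff K w ∘ₗ (LiePT K).toSubmodule.subtype := by
    refine b.ext fun j => ?_
    simp only [LinearMap.sum_apply, LinearMap.smul_apply, Module.Basis.coord_apply,
      Module.Basis.repr_self, Finsupp.single_apply, smul_eq_mul, mul_ite, mul_one, mul_zero,
      Finset.sum_ite_eq, LinearMap.comp_apply]
    split_ifs with hj
    · rfl
    · by_contra hne
      exact hj (mem_basisUpTo_of_coeff hb hw fun h0 => hne h0.symm)
  have := LinearMap.congr_fun h x
  rw [LinearMap.sum_apply] at this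
  exact this

open Classical in
/-- The coproduct of a basis element as a finite sum, without labellings: composition adds up the
numbers of vertices, so that only basis elements with at most `n` vertices contribute. -/
theorem deltaQBasis_eq [CharZero K] (hb : ∀ i, b i = LieMonomial.eval K (β i)) {n : ℕ} {i : ι}
    (hi : i ∈ basisUpTo hb n) : deltaQBasis β b i =
      ∑ j ∈ basisUpTo hb n, ∑ f : LieMonomial.Vert (β j) → basisUpTo hb n,
        b.repr ⟨LieMonomial.subst (β j) fun v => (b (f v) : OF K),
          LieMonomial.subst_mem _ _ fun v => (b (f v)).2⟩ i •
        ((∏ v, SymmetricAlgebra.ι K (LiePT K) (b (f v))) ⊗ₜ[K]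
          SymmetricAlgebra.ι K (LiePT K) (b j)) := by
  have hrepr (j : ι) (f : LieMonomial.Vert (β j) → ι)
      (hf : b.repr ⟨LieMonomial.subst (β j) fun v => (b (f v) : OF K),
          LieMonomial.subst_mem _ _ fun v => (b (f v)).2⟩ i ≠ 0) :
      ∑ v, Fintype.card (LieMonomial.Vert (β (f v))) ≤ n := by
    rw [mem_basisUpTo] at hi
    refine le_trans (not_lt.1 fun hlt => hf ?_) hi
    refine repr_eq_zero_of_isHomogeneous hb ?_ hlt.ne
    exact isHomogeneous_subst _ _ _ fun v => isHomogeneous_basis hb (f v)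
  have key (j : ι) : (∑ σ : LieMonomial.Vert (β j) ≃ Fin (Fintype.card (LieMonomial.Vert (β j))),
      ∑ᶠ k : Fin (Fintype.card (LieMonomial.Vert (β j))) → ι,
        (((Nat.factorial (Fintype.card (LieMonomial.Vert (β j))) : ℕ) : K)⁻¹ *
          b.repr ⟨LieMonomial.subst (β j) fun v => (b (k (σ v)) : OF K),
            LieMonomial.subst_mem _ _ fun v => (b (k (σ v))).2⟩ i) •
        ((∏ l, SymmetricAlgebra.ι K (LiePT K) (b (k l))) ⊗ₜ[K]
          SymmetricAlgebra.ι K (LiePT K) (b j))) =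
      ∑ f : LieMonomial.Vert (β j) → basisUpTo hb n,
        b.repr ⟨LieMonomial.subst (β j) fun v => (b (f v) : OF K),
          LieMonomial.subst_mem _ _ fun v => (b (f v)).2⟩ i •
        ((∏ v, SymmetricAlgebra.ι K (LiePT K) (b (f v))) ⊗ₜ[K]
          SymmetricAlgebra.ι K (LiePT K) (b j)) := by
    let G (f : LieMonomial.Vert (β j) → ι) : Q K ⊗[K] Q K :=
      b.repr ⟨LieMonomial.subst (β j) fun v => (b (f v) : OF K),
          LieMonomial.subst_mem _ _ fun v => (b (f v)).2⟩ i •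
        ((∏ v, SymmetricAlgebra.ι K (LiePT K) (b (f v))) ⊗ₜ[K]
          SymmetricAlgebra.ι K (LiePT K) (b j))
    have hG (f : LieMonomial.Vert (β j) → ι) (hf : G f ≠ 0) (v : LieMonomial.Vert (β j)) :
        f v ∈ basisUpTo hb n := by
      rw [mem_basisUpTo]
      refine le_of_mem_sum (fun v => Fintype.card (LieMonomial.Vert (β (f v)))) ?_ v
      refine hrepr j f fun h0 => hf ?_
      simp only [G, h0, zero_smul]
    have hs := sum_labellings (K := K) (basisUpTo hb n) G hG
    have h1 (σ : LieMonomial.Vert (β j) ≃ Fin (Fintype.card (LieMonomial.Vert (β j))))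
        (k : Fin (Fintype.card (LieMonomial.Vert (β j))) → ι) :
        ∏ v, SymmetricAlgebra.ι K (LiePT K) (b (k (σ v))) =
          ∏ l, SymmetricAlgebra.ι K (LiePT K) (b (k l)) :=
      Equiv.prod_comp σ fun l => SymmetricAlgebra.ι K (LiePT K) (b (k l))
    simp only [G, h1, smul_smul] at hs
    exact hs
  rw [deltaQBasis]
  simp only [key]
  refine finsum_eq_sum_of_support_subset _ fun j hj => ?_
  obtain ⟨f, _, hf⟩ := Finset.exists_ne_zero_of_sum_ne_zero hj
  refine (mem_basisUpTo hb).2 (le_trans ?_ (hrepr j (fun v => f v) fun h0 => hf ?_))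
  · -- each vertex of `β j` is replaced by a Lie polynomial with at least one vertex
    rw [← Finset.card_univ, Finset.card_eq_sum_ones]
    exact Finset.sum_le_sum fun v _ => card_vert_pos _
  · simp only [h0, zero_smul]

/-- The coproduct of `Q` on the generic Lie polynomial is the transpose of its substitution into
itself. -/
theorem deltaQ_generic [CharZero K] (hb : ∀ i, b i = LieMonomial.eval K (β i)) (w : Forest) :
    deltaQ β b (generic b w) =
      coact (generic b) (fun u => (1 : Q K) ⊗ₜ[K] generic b u) w := by
  classical
  set n := size w with hn
  have hι (i : ι) : deltaQ β b (SymmetricAlgebra.ι K (LiePT K) (b i)) = deltaQBasis β b i := by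
    rw [deltaQ, SymmetricAlgebra.lift_ι_apply, Module.Basis.constr_basis]
  have hA := (isPrimitive_generic hb).nil
  calc _ = ∑ i ∈ basisUpTo hb n, coeff K w (b i : OF K) • deltaQBasis β b i := by
        rw [generic_eq_sum hb hn.ge, map_sum]
        simp only [map_smul, hι]
    _ = ∑ j ∈ basisUpTo hb n, ∑ f : LieMonomial.Vert (β j) → basisUpTo hb n,
          coeff K w (LieMonomial.subst (β j) fun v => (b (f v) : OF K)) •
          ((∏ v, SymmetricAlgebra.ι K (LiePT K) (b (f v))) ⊗ₜ[K]
            SymmetricAlgebra.ι K (LiePT K) (b j)) := by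
        rw [Finset.sum_congr rfl fun i hi => by rw [deltaQBasis_eq hb hi]]
        simp only [Finset.smul_sum, smul_smul]
        rw [Finset.sum_comm]
        refine Finset.sum_congr rfl fun j _ => ?_
        rw [Finset.sum_comm]
        refine Finset.sum_congr rfl fun f _ => ?_
        rw [← Finset.sum_smul, sum_coeff_mul_repr hb hn.ge]
    _ = ∑ j ∈ basisUpTo hb n, seriesMonomial (generic b) (β j) w ⊗ₜ[K]
          SymmetricAlgebra.ι K (LiePT K) (b j) := by
        refine Finset.sum_congr rfl fun j _ => ?_
        rw [seriesMonomial_congr fun v hv => generic_eq_combination hb hv,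
          seriesMonomial_combination, TensorProduct.sum_tmul]
        refine Finset.sum_congr rfl fun f _ => ?_
        rw [TensorProduct.smul_tmul']
    _ = lsum (forestsUpTo n) fun u => seriesForest (generic b) u w ⊗ₜ[K] generic b u := by
        have h1 (u : Forest) : seriesForest (generic b) u w ⊗ₜ[K] generic b u =
            ∑ j ∈ basisUpTo hb n, (coeff K u (b j : OF K) • seriesForest (generic b) u w) ⊗ₜ[K]
              SymmetricAlgebra.ι K (LiePT K) (b j) := by
          by_cases hu : size u ≤ n
          · rw [generic_eq_sum hb hu, TensorProduct.tmul_sum]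
            refine Finset.sum_congr rfl fun j _ => ?_
            rw [TensorProduct.smul_tmul]
          · simp [seriesForest_eq_zero hA (not_le.1 hu)]
        simp only [h1]
        rw [lsum_finset_sum]
        refine Finset.sum_congr rfl fun j _ => ?_
        rw [← seriesLin_eval (K := K) hA, ← hb, seriesLin]
        exact map_lsum (TensorProduct.mk K (Q K) (Q K) |>.flip
          (SymmetricAlgebra.ι K (LiePT K) (b j))) _ _
    _ = _ := by
        rw [coact, coactUpTo]
        simp only [TensorProduct.smul_tmul', smul_eq_mul, mul_one]
        rw [hn]

end Generic

/-! ### The Munthe-Kaas–Wright Hopf algebra -/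

section HopfAlgebra

variable (K : Type*) [Field K]

theorem shuffle_forest (u w : Forest) :
    shuffle K (forest K u) (forest K w) = shuf u w (forest K) := by
  rw [shuffle, bilin, ← forestBasis_apply, ← forestBasis_apply, Module.Basis.constr_basis,
    Module.Basis.constr_basis]
  rfl

theorem deltaN_forest (w : Forest) :
    deltaN K (forest K w) = cut w fun p q => forest K p ⊗ₜ[K] forest K q := by
  rw [deltaN, ← forestBasis_apply, Module.Basis.constr_basis]
  rfl

variable {K}

theorem map_cut {M N : Type*} [AddCommMonoid M] [AddCommMonoid N] [Module K M] [Module K N]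
    (g : M →ₗ[K] N) (w : Forest) (H : Forest → Forest → M) :
    g (cut w H) = cut w fun p q => g (H p q) := map_lsum g _ _

theorem map_shuf {M N : Type*} [AddCommMonoid M] [AddCommMonoid N] [Module K M] [Module K N]
    (g : M →ₗ[K] N) (x y : Forest) (f : Forest → M) :
    g (shuf x y f) = shuf x y fun w => g (f w) := map_lsum g _ _

theorem cut_tmul {M N : Type*} [AddCommMonoid M] [AddCommMonoid N] [Module K M] [Module K N]
    (w : Forest) (H : Forest → Forest → M) (n : N) :
    cut w H ⊗ₜ[K] n = cut w fun p q => H p q ⊗ₜ[K] n :=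
  map_cut ((TensorProduct.mk K M N).flip n) w H

theorem tmul_cut {M N : Type*} [AddCommMonoid M] [AddCommMonoid N] [Module K M] [Module K N]
    (w : Forest) (m : M) (H : Forest → Forest → N) :
    m ⊗ₜ[K] cut w H = cut w fun p q => m ⊗ₜ[K] H p q :=
  map_cut (TensorProduct.mk K M N m) w H

theorem shuf_tmul_shuf {M N : Type*} [AddCommMonoid M] [AddCommMonoid N] [Module K M] [Module K N]
    (x y x' y' : Forest) (f : Forest → M) (g : Forest → N) :
    shuf x y f ⊗ₜ[K] shuf x' y' g = shuf x y fun u => shuf x' y' fun v => f u ⊗ₜ[K] g v := by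
  have h := map_shuf ((TensorProduct.mk K M N).flip (shuf x' y' g)) x y f
  refine h.trans (shuf_congr fun u => ?_)
  exact map_shuf (TensorProduct.mk K M N (f u)) x' y' g

theorem map₂_cut {M : Type*} [AddCommMonoid M] [Module K M]
    (B : M →ₗ[K] M →ₗ[K] M) (w w' : Forest) (H H' : Forest → Forest → M) :
    B (cut w H) (cut w' H') = cut w fun p q => cut w' fun p' q' => B (H p q) (H' p' q') := by
  have h := map_cut (B.flip (cut w' H')) w H
  refine h.trans (cut_congr fun p q => ?_)
  exact map_cut (B (H p q)) w' H'

theorem coeff_nil_forest (w : Forest) : coeff K [] (forest K w) = onNil w 1 := by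
  cases w with
  | nil => rw [forest_nil, coeff_one]
  | cons t w => rw [coeff_nil_forest_cons]; rfl

theorem shuffle_one_left (x : OF K) : shuffle K (forest K []) x = x := by
  induction x using forestSpan_induction with
  | hw u => rw [shuffle_forest, shuf_nil_left]
  | hadd y z hy hz => rw [map_add, hy, hz]
  | hsmul c y hy => rw [map_smul, hy]

theorem shuffle_one_right (x : OF K) : shuffle K x (forest K []) = x := by
  induction x using forestSpan_induction with
  | hw u => rw [shuffle_forest, shuf_nil_right]
  | hadd y z hy hz => rw [map_add, LinearMap.add_apply, hy, hz]
  | hsmul c y hy => rw [map_smul, LinearMap.smul_apply, hy]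

theorem shuffle_assoc (x y z : OF K) :
    shuffle K (shuffle K x y) z = shuffle K x (shuffle K y z) := by
  induction x using forestSpan_induction with
  | hw u =>
    induction y using forestSpan_induction with
    | hw v =>
      induction z using forestSpan_induction with
      | hw w =>
        have h := map_shuf ((shuffle K).flip (forest K w)) u v (forest K)
        simp only [LinearMap.flip_apply] at h
        rw [shuffle_forest K u, shuffle_forest K v, h, map_shuf]
        simp only [shuffle_forest]
        exact shuf_assoc _ _ _ _
      | hadd a b ha hb => simp only [map_add, ha, hb]
      | hsmul c a ha => simp only [map_smul, ha]
    | hadd a b ha hb => simp only [map_add, LinearMap.add_apply, ha, hb]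
    | hsmul c a ha => simp only [map_smul, LinearMap.smul_apply, ha]
  | hadd a b ha hb => simp only [map_add, LinearMap.add_apply, ha, hb]
  | hsmul c a ha => simp only [map_smul, LinearMap.smul_apply, ha]

variable (K) in
theorem isBialgebra_deltaN :
    IsBialgebra (shuffle K) (forest K []) (deltaN K) (coeff K []) where
  mul_assoc := shuffle_assoc
  one_mul := shuffle_one_left
  mul_one := shuffle_one_right
  coassoc x := by
    induction x using forestSpan_induction with
    | hw w =>
      simp only [deltaN_forest, map_cut, LinearMap.rTensor_tmul, LinearMap.lTensor_tmul,
        cut_tmul, tmul_cut]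
      have h := map_cut (TensorProduct.assoc K (OF K) (OF K) (OF K)).toLinearMap
      simp only [LinearEquiv.coe_coe] at h
      simp only [h, TensorProduct.assoc_tmul]
      exact (cut_cut w fun a b c => forest K a ⊗ₜ[K] (forest K b ⊗ₜ[K] forest K c)).symm
    | hadd a b ha hb => simp only [map_add, ha, hb]
    | hsmul c a ha => simp only [map_smul, ha]
  counit_left x := by
    induction x using forestSpan_induction with
    | hw w =>
      have h := map_cut (TensorProduct.lid K (OF K)).toLinearMap
      simp only [LinearEquiv.coe_coe] at h
      simp only [deltaN_forest, map_cut, LinearMap.rTensor_tmul, h, TensorProduct.lid_tmul,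
        coeff_nil_forest, onNil_smul]
      exact cut_onNil_left w (forest K)
    | hadd a b ha hb => simp only [map_add, ha, hb]
    | hsmul c a ha => simp only [map_smul, ha]
  counit_right x := by
    induction x using forestSpan_induction with
    | hw w =>
      have h := map_cut (TensorProduct.rid K (OF K)).toLinearMap
      simp only [LinearEquiv.coe_coe] at h
      simp only [deltaN_forest, map_cut, LinearMap.lTensor_tmul, h, TensorProduct.rid_tmul,
        coeff_nil_forest, onNil_smul]
      exact cut_onNil_right w (forest K)
    | hadd a b ha hb => simp only [map_add, ha, hb]
    | hsmul c a ha => simp only [map_smul, ha]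
  comul_mul x y := by
    induction x using forestSpan_induction with
    | hw u =>
      induction y using forestSpan_induction with
      | hw v =>
        simp only [shuffle_forest, map_shuf, deltaN_forest, map₂_cut, TensorProduct.map₂_apply_tmul,
          TensorProduct.map_tmul, shuf_cut, shuf_tmul_shuf]
      | hadd a b ha hb => simp only [map_add, ha, hb]
      | hsmul c a ha => simp only [map_smul, ha]
    | hadd a b ha hb => simp only [map_add, LinearMap.add_apply, ha, hb]
    | hsmul c a ha => simp only [map_smul, LinearMap.smul_apply, ha]
  counit_mul x y := by
    induction x using forestSpan_induction with
    | hw u =>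
      induction y using forestSpan_induction with
      | hw v =>
        simp only [shuffle_forest, map_shuf, coeff_nil_forest, shuf_onNil]
        cases u <;> cases v <;> simp
      | hadd a b ha hb => simp only [map_add, ha, hb, mul_add]
      | hsmul c a ha => simp only [map_smul, ha, smul_eq_mul, mul_left_comm]
    | hadd a b ha hb => simp only [map_add, LinearMap.add_apply, ha, hb, add_mul]
    | hsmul c a ha => simp only [map_smul, LinearMap.smul_apply, ha, smul_eq_mul, mul_assoc]
  comul_one := by rw [deltaN_forest, cut_nil]
  counit_one := by rw [coeff_nil_forest, onNil_nil]

end HopfAlgebra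

/-! ### The coproduct of `Q` and composition -/

section Cointeraction

variable {K : Type*} [Field K] {ι : Type*} {β : ι → LieMonomial}
  {b : Module.Basis ι K (LiePT K)}

/-- The coaction as a sum of tensors, over any sufficiently large set of forests. -/
theorem coact_tmul_eq {M : Type*} [AddCommGroup M] [Module K M]
    (hb : ∀ i, b i = LieMonomial.eval K (β i)) (φ : Forest → M) {n : ℕ} {w : Forest}
    (hw : size w ≤ n) : coact (generic b) (fun u => (1 : Q K) ⊗ₜ[K] φ u) w =
      lsum (forestsUpTo n) fun u => seriesForest (generic b) u w ⊗ₜ[K] φ u := by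
  rw [← coactUpTo_eq (isPrimitive_generic hb).nil hw, coactUpTo]
  simp only [TensorProduct.smul_tmul', smul_eq_mul, mul_one]

theorem isPrimitive_map {R S : Type*} [CommRing R] [CommRing S] (φ : R →+* S) {A : Forest → R}
    (hA : IsPrimitive A) : IsPrimitive fun w => φ (A w) := by
  refine ⟨by rw [hA.nil, map_zero], fun x y => ?_⟩
  have h : (shuf x y fun w => φ (A w)) = φ (shuf x y A) := (map_lsum φ _ _).symm
  rw [h, hA.shuf]
  cases x <;> cases y <;> simp

/-- The coproduct of `Q` is dual to the composition of substitutions. -/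
theorem deltaQ_seriesForest [CharZero K] (hb : ∀ i, b i = LieMonomial.eval K (β i))
    (u w : Forest) : deltaQ β b (seriesForest (generic b) u w) =
      lsum (forestsUpTo (size w)) fun v =>
        seriesForest (generic b) v w ⊗ₜ[K] seriesForest (generic b) u v := by
  let l : Q K →+* Q K ⊗[K] Q K := (Algebra.TensorProduct.includeLeft : Q K →ₐ[K] _).toRingHom
  let r : Q K →+* Q K ⊗[K] Q K := (Algebra.TensorProduct.includeRight : Q K →ₐ[K] _).toRingHom
  have hA : IsPrimitive fun v => l (generic b v) := isPrimitive_map l (isPrimitive_generic hb)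
  have hl (f : Forest → Q K) (w : Forest) : coact (fun v => l (generic b v)) (fun v => r (f v)) w =
      lsum (forestsUpTo (size w)) fun v => seriesForest (generic b) v w ⊗ₜ[K] f v := by
    rw [coact, coactUpTo]
    refine lsum_congr fun v _ => ?_
    rw [← map_seriesForest]
    simp [l, r, Algebra.TensorProduct.tmul_mul_tmul]
  have h1 := map_seriesForest (A := generic b) (deltaQ β b).toRingHom u w
  refine h1.trans ?_
  have h2 : (fun v => (deltaQ β b).toRingHom (generic b v)) =
      coact (fun v => l (generic b v)) fun v => r (generic b v) := by
    funext v
    rw [hl]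
    exact (deltaQ_generic hb v).trans (coact_tmul_eq hb _ le_rfl)
  rw [h2, ← coact_seriesForest hA, ← hl]
  refine coact_congr fun v => ?_
  exact (map_seriesForest r u v).symm

/-- The coassociativity of a map `ψ` that is the transpose of the substitution of the generic Lie
polynomial. It is applied to the coproduct of `Q` and to the coaction. -/
theorem assoc_deltaQ_coact [CharZero K] (hb : ∀ i, b i = LieMonomial.eval K (β i))
    {M : Type*} [AddCommGroup M] [Module K M] (φ : Forest → M) {ψ : M →ₗ[K] Q K ⊗[K] M}
    (hψ : ∀ w, ψ (φ w) = coact (generic b) (fun u => (1 : Q K) ⊗ₜ[K] φ u) w) (w : Forest) :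
    TensorProduct.assoc K (Q K) (Q K) M ((deltaQ β b).toLinearMap.rTensor M (ψ (φ w))) =
      ψ.lTensor (Q K) (ψ (φ w)) := by
  have hA := (isPrimitive_generic hb).nil
  rw [hψ, coact_tmul_eq hb φ le_rfl, ← LinearEquiv.coe_coe, map_lsum, map_lsum, map_lsum]
  have e1 (u : Forest) : (TensorProduct.assoc K (Q K) (Q K) M).toLinearMap
      ((deltaQ β b).toLinearMap.rTensor M (seriesForest (generic b) u w ⊗ₜ[K] φ u)) =
      lsum (forestsUpTo (size w)) fun v => seriesForest (generic b) v w ⊗ₜ[K]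
        (seriesForest (generic b) u v ⊗ₜ[K] φ u) := by
    rw [LinearMap.rTensor_tmul, AlgHom.toLinearMap_apply, deltaQ_seriesForest hb]
    have h := map_lsum ((TensorProduct.mk K (Q K ⊗[K] Q K) M).flip (φ u))
      (forestsUpTo (size w)) fun v =>
        seriesForest (generic b) v w ⊗ₜ[K] seriesForest (generic b) u v
    simp only [LinearMap.flip_apply, TensorProduct.mk_apply] at h
    rw [h, map_lsum]
    rfl
  have e2 (v : Forest) : ψ.lTensor (Q K) (seriesForest (generic b) v w ⊗ₜ[K] φ v) =
      lsum (forestsUpTo (size w)) fun u => seriesForest (generic b) v w ⊗ₜ[K]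
        (seriesForest (generic b) u v ⊗ₜ[K] φ u) := by
    rw [LinearMap.lTensor_tmul, hψ]
    by_cases hv : size v ≤ size w
    · rw [coact_tmul_eq hb φ hv]
      exact map_lsum (TensorProduct.mk K (Q K) (Q K ⊗[K] M) _) _ _
    · simp [seriesForest_eq_zero hA (not_le.1 hv), lsum_zero]
  simp only [e1, e2]
  exact lsum_comm _ _ _

/-! ### The counit of `Q` -/

/-- The single-vertex tree is the only Lie monomial with one vertex. -/
theorem eq_bullet_of_card_vert_eq_one {m : LieMonomial}
    (h : Fintype.card (LieMonomial.Vert m) = 1) : m = .of bullet := by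
  rcases m with ⟨⟨c⟩⟩ | ⟨x, y⟩
  · have h' : size c + 1 = 1 := (card_vert_node c).symm.trans h
    by_cases hc : c = []
    · rw [hc]; rfl
    · have := size_pos hc
      omega
  · have hx := card_vert_pos x
    have hy := card_vert_pos y
    have h' : Fintype.card (LieMonomial.Vert x) + Fintype.card (LieMonomial.Vert y) = 1 :=
      Fintype.card_sum.symm.trans h
    omega

theorem epsilonQ_ι (x : LiePT K) :
    epsilonQ (SymmetricAlgebra.ι K (LiePT K) x) = coeff K [bullet] (x : OF K) := by
  rw [epsilonQ, SymmetricAlgebra.lift_ι_apply]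
  rfl

/-- The counit turns the generic Lie polynomial into the single-vertex tree. -/
theorem epsilonQ_generic (hb : ∀ i, b i = LieMonomial.eval K (β i)) (w : Forest) :
    epsilonQ (generic b w) = coeff K w (forest K [bullet]) := by
  have hsize : size [bullet] = 1 := size_cons [] []
  have h1 (i : ι) (hi : coeff K [bullet] (b i : OF K) ≠ 0) : b i = treeLie K bullet := by
    rw [hb, eq_bullet_of_card_vert_eq_one (m := β i)]
    · rfl
    · by_contra hne
      exact hi (isHomogeneous_basis hb i _ (by omega))
  -- the basis contains the single-vertex tree, since it spans `Lie(PT)`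
  obtain ⟨i, hi⟩ : ∃ i, coeff K [bullet] (b i : OF K) ≠ 0 := by
    by_contra! h
    have h0 : coeff K [bullet] ∘ₗ (LiePT K).toSubmodule.subtype = 0 := b.ext h
    have h2 : coeff K [bullet] (forest K [bullet]) = 0 :=
      LinearMap.congr_fun h0 (treeLie K bullet)
    rw [coeff_forest, if_pos rfl] at h2
    exact one_ne_zero h2
  rw [generic_eq_sum hb le_rfl, map_sum, Finset.sum_eq_single i]
  · have h2 : ((treeLie K bullet : LiePT K) : OF K) = forest K [bullet] := rfl
    rw [map_smul, epsilonQ_ι, h1 i hi, h2, coeff_forest K [bullet] [bullet], if_pos rfl,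
      smul_eq_mul, mul_one]
  · intro j _ hj
    rw [map_smul, epsilonQ_ι]
    have : coeff K [bullet] (b j : OF K) = 0 := by
      by_contra hne
      exact hj (b.injective ((h1 j hne).trans (h1 i hi).symm))
    rw [this, smul_zero]
  · intro hnot
    rw [map_smul, epsilonQ_ι]
    have : coeff K w (b i : OF K) = 0 := by
      by_contra hne
      exact hnot (mem_basisUpTo_of_coeff hb le_rfl hne)
    rw [this, zero_smul]

/-- Substituting the single-vertex tree changes nothing. -/
theorem seriesForest_bullet (u w : Forest) :
    seriesForest (fun v => coeff K v (forest K [bullet])) u w = coeff K w (forest K u) := by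
  have hbullet : forest K [bullet] = forest K (PTree.node [] :: []) := rfl
  induction u using forest_induction generalizing w with
  | nil => rw [seriesForest_nil, forest_nil, coeff_one]
  | cons c d hc hd =>
    have h : forest K (PTree.node c :: d) = forest K [PTree.node c] * forest K d := by
      rw [← forest_append, List.singleton_append]
    have key (v : Forest) : (prune v fun p q => coeff K p (forest K c) *
        coeff K q (forest K [bullet])) = coeff K v (forest K [PTree.node c]) := by
      rcases v with _ | ⟨⟨c'⟩, d'⟩
      · rw [prune_nil, hbullet, coeff_nil_forest_cons, coeff_nil_forest_cons, mul_zero]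
      · have e (p p' r q : Forest) : (shuf p p' fun a => coeff K a (forest K c) *
            coeff K (PTree.node r :: q) (forest K [bullet])) =
            onNil r (onNil q (shuf p p' fun a => coeff K a (forest K c))) := by
          rw [hbullet]
          simp only [coeff_cons_forest_cons, forest_nil, coeff_one]
          cases r <;> cases q <;> simp [shuf_zero]
        rw [prune_cons, coeff_cons_forest_cons]
        simp only [e]
        have e1 (p r : Forest) : (prune d' fun p' q => onNil r (onNil q (shuf p p' fun a =>
            coeff K a (forest K c)))) = onNil r (onNil d' (coeff K p (forest K c))) := by
          cases r with
          | nil =>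
            have := prune_onNil_right d' fun p' => shuf p p' fun a => coeff K a (forest K c)
            rw [shuf_nil_right] at this
            exact this
          | cons => exact prune_zero _
        simp only [e1]
        have := cut_onNil_right c' fun p => onNil d' (coeff K p (forest K c))
        rw [this, forest_nil, coeff_one]
        cases d' <;> simp
    rw [seriesForest_cons, h, coeff_mul]
    simp only [hc, hd, key]

theorem epsilonQ_seriesForest (hb : ∀ i, b i = LieMonomial.eval K (β i)) (u w : Forest) :
    epsilonQ (seriesForest (generic b) u w) = coeff K w (forest K u) := by
  have h := map_seriesForest (A := generic b) (epsilonQ (K := K)).toRingHom u w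
  refine h.trans ?_
  have h2 : (fun v => (epsilonQ (K := K)).toRingHom (generic b v)) =
      fun v => coeff K v (forest K [bullet]) := funext fun v => epsilonQ_generic hb v
  rw [h2, seriesForest_bullet]

/-- The left counit identity, for the coaction and for the coproduct of `Q`. -/
theorem lid_epsilonQ_coact (hb : ∀ i, b i = LieMonomial.eval K (β i))
    {M : Type*} [AddCommGroup M] [Module K M] (φ : Forest → M) (w : Forest) :
    TensorProduct.lid K M ((epsilonQ (K := K)).toLinearMap.rTensor M
      (coact (generic b) (fun u => (1 : Q K) ⊗ₜ[K] φ u) w)) = φ w := by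
  rw [coact_tmul_eq hb φ le_rfl, ← LinearEquiv.coe_coe, map_lsum, map_lsum]
  simp only [LinearMap.rTensor_tmul, AlgHom.toLinearMap_apply, epsilonQ_seriesForest hb,
    LinearEquiv.coe_coe, TensorProduct.lid_tmul]
  simp only [coeff_forest_comm _ w]
  exact lsum_coeff_forest_smul le_rfl φ

/-- Substituting the generic Lie polynomial into the single-vertex tree gives the generic Lie
polynomial. -/
theorem rid_epsilonQ_coact_generic (hb : ∀ i, b i = LieMonomial.eval K (β i)) (w : Forest) :
    TensorProduct.rid K (Q K) ((epsilonQ (K := K)).toLinearMap.lTensor (Q K)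
      (coact (generic b) (fun u => (1 : Q K) ⊗ₜ[K] generic b u) w)) = generic b w := by
  rw [coact_tmul_eq hb _ (Nat.le_succ _), ← LinearEquiv.coe_coe, map_lsum, map_lsum]
  simp only [LinearMap.lTensor_tmul, AlgHom.toLinearMap_apply, epsilonQ_generic hb,
    LinearEquiv.coe_coe, TensorProduct.rid_tmul]
  have hsize : size [bullet] = 1 := size_cons [] []
  rw [lsum_coeff_forest_smul (by omega) fun u => seriesForest (generic b) u w,
    seriesForest_singleton, bullet, seriesTree, ← prune_onNil_left w (generic b)]
  refine prune_congr fun p q => ?_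
  rw [seriesForest_nil]
  cases p <;> simp

/-- The coefficients of the generic Lie polynomial generate `Q`. -/
theorem algHom_eq_of_forall_generic (hb : ∀ i, b i = LieMonomial.eval K (β i)) {S : Type*}
    [CommRing S] [Algebra K S] {F G : Q K →ₐ[K] S}
    (h : ∀ w, F (generic b w) = G (generic b w)) : F = G :=
  SymmetricAlgebra.algHom_ext
    (b.ext (eq_of_forall_generic hb (F := F.toLinearMap) (G := G.toLinearMap) h))

theorem isBialgebra_deltaQ [CharZero K] (hb : ∀ i, b i = LieMonomial.eval K (β i)) :
    IsBialgebra (LinearMap.mul K (Q K)) 1 (deltaQ β b).toLinearMap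
      (epsilonQ (K := K)).toLinearMap where
  mul_assoc x y z := mul_assoc x y z
  one_mul x := one_mul x
  mul_one x := mul_one x
  coassoc x := by
    have h : ((Algebra.TensorProduct.assoc K K K (Q K) (Q K) (Q K)).toAlgHom.comp
        (Algebra.TensorProduct.map (deltaQ β b) (AlgHom.id K (Q K)))).comp (deltaQ β b) =
        (Algebra.TensorProduct.map (AlgHom.id K (Q K)) (deltaQ β b)).comp (deltaQ β b) := by
      refine algHom_eq_of_forall_generic hb (S := Q K ⊗[K] (Q K ⊗[K] Q K)) fun w => ?_
      exact assoc_deltaQ_coact hb (generic b) (ψ := (deltaQ β b).toLinearMap)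
        (fun w => deltaQ_generic hb w) w
    exact DFunLike.congr_fun h x
  counit_left x := by
    have h : ((Algebra.TensorProduct.lid K (Q K)).toAlgHom.comp
        (Algebra.TensorProduct.map epsilonQ (AlgHom.id K (Q K)))).comp (deltaQ β b) =
        AlgHom.id K (Q K) := by
      refine algHom_eq_of_forall_generic hb fun w => ?_
      exact (congrArg _ (congrArg _ (deltaQ_generic hb w))).trans
        (lid_epsilonQ_coact hb (generic b) w)
    exact DFunLike.congr_fun h x
  counit_right x := by
    have h : ((Algebra.TensorProduct.rid K K (Q K)).toAlgHom.comp
        (Algebra.TensorProduct.map (AlgHom.id K (Q K)) epsilonQ)).comp (deltaQ β b) =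
        AlgHom.id K (Q K) := by
      refine algHom_eq_of_forall_generic hb fun w => ?_
      exact (congrArg _ (congrArg _ (deltaQ_generic hb w))).trans
        (rid_epsilonQ_coact_generic hb w)
    exact DFunLike.congr_fun h x
  comul_mul x y := by
    have h : ∀ s t : Q K ⊗[K] Q K,
        s * t = TensorProduct.map₂ (LinearMap.mul K (Q K)) (LinearMap.mul K (Q K)) s t := by
      intro s t
      induction s using TensorProduct.induction_on with
      | zero => simp
      | tmul a c =>
        induction t using TensorProduct.induction_on with
        | zero => simp
        | tmul a' c' => simp [TensorProduct.map₂_apply_tmul]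
        | add x y hx hy => rw [mul_add, map_add, hx, hy]
      | add x y hx hy => rw [add_mul, map_add, LinearMap.add_apply, hx, hy]
    exact (map_mul (deltaQ β b) x y).trans (h _ _)
  counit_mul x y := map_mul (epsilonQ (K := K)) x y
  comul_one := map_one (deltaQ β b)
  counit_one := map_one (epsilonQ (K := K))

/-! ### The cointeraction -/

/-- Products of values of the coaction: substitution into two forests at the same time. -/
theorem map₂_coact (hb : ∀ i, b i = LieMonomial.eval K (β i)) {M N P : Type*} [AddCommGroup M]
    [AddCommGroup N] [AddCommGroup P] [Module K M] [Module K N] [Module K P]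
    (B : M →ₗ[K] N →ₗ[K] P) (φ : Forest → M) (ψ : Forest → N) (x y : Forest) :
    TensorProduct.map₂ (LinearMap.mul K (Q K)) B
      (coact (generic b) (fun u => (1 : Q K) ⊗ₜ[K] φ u) x)
      (coact (generic b) (fun u => (1 : Q K) ⊗ₜ[K] ψ u) y) =
      coact (generic b) (fun u => coact (generic b) (fun v => (1 : Q K) ⊗ₜ[K] B (φ u) (ψ v)) y)
        x := by
  rw [coact_tmul_eq hb φ le_rfl, coact_tmul_eq hb ψ le_rfl]
  have h := map_lsum ((TensorProduct.map₂ (LinearMap.mul K (Q K)) B).flip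
    (lsum (forestsUpTo (size y)) fun v => seriesForest (generic b) v y ⊗ₜ[K] ψ v))
    (forestsUpTo (size x)) fun u => seriesForest (generic b) u x ⊗ₜ[K] φ u
  refine h.trans (lsum_congr fun u _ => ?_)
  rw [LinearMap.flip_apply, map_lsum]
  simp only [TensorProduct.map₂_apply_tmul, TensorProduct.map_tmul, LinearMap.mul_apply', coact,
    coactUpTo, smul_lsum, TensorProduct.smul_tmul', smul_eq_mul, mul_one]

/-- The coaction is multiplicative because the generic Lie polynomial is primitive. -/
theorem rho_shuffle [CharZero K] (hb : ∀ i, b i = LieMonomial.eval K (β i)) (x y : OF K) :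
    rho b (shuffle K x y) =
      TensorProduct.map₂ (LinearMap.mul K (Q K)) (shuffle K) (rho b x) (rho b y) := by
  induction x using forestSpan_induction with
  | hw u =>
    induction y using forestSpan_induction with
    | hw v =>
      rw [shuffle_forest, map_shuf]
      simp only [rho_forest hb]
      rw [shuf_coact (isPrimitive_generic hb), map₂_coact hb]
      refine coact_congr fun u => coact_congr fun v => ?_
      rw [shuffle_forest]
      exact (map_shuf (TensorProduct.mk K (Q K) (OF K) 1) u v (forest K)).symm
    | hadd a c ha hc => simp only [map_add, ha, hc]
    | hsmul r a ha => simp only [map_smul, ha]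
  | hadd a c ha hc => simp only [map_add, LinearMap.add_apply, ha, hc]
  | hsmul r a ha => simp only [map_smul, LinearMap.smul_apply, ha]

/-- The coproduct of `H_N` is compatible with the coaction because the substitution of a primitive
series respects the Grossman–Larson product. -/
theorem deltaN_rho [CharZero K] (hb : ∀ i, b i = LieMonomial.eval K (β i)) (x : OF K) :
    (deltaN K).lTensor (Q K) (rho b x) = mul13 (OF K) (LinearMap.mul K (Q K))
      (TensorProduct.map (rho b) (rho b) (deltaN K x)) := by
  induction x using forestSpan_induction with
  | hw w =>
    have h (s t : Q K ⊗[K] OF K) : mul13 (OF K) (LinearMap.mul K (Q K)) (s ⊗ₜ[K] t) =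
        TensorProduct.map₂ (LinearMap.mul K (Q K)) (TensorProduct.mk K (OF K) (OF K)) s t := by
      have e : (TensorProduct.mk K _ _).compr₂ (mul13 (OF K) (LinearMap.mul K (Q K))) =
          TensorProduct.map₂ (LinearMap.mul K (Q K)) (TensorProduct.mk K (OF K) (OF K)) := by
        refine TensorProduct.ext' fun a c => TensorProduct.ext' fun a' c' => ?_
        simp [mul13, TensorProduct.map₂_apply_tmul]
      exact LinearMap.congr_fun₂ e s t
    have hl : (deltaN K).lTensor (Q K) (rho b (forest K w)) = coact (generic b)
        (fun u => cut u fun p q => (1 : Q K) ⊗ₜ[K] (forest K p ⊗ₜ[K] forest K q)) w := by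
      rw [rho_forest hb, coact_tmul_eq hb _ le_rfl, map_lsum]
      simp only [LinearMap.lTensor_tmul, ← coact_tmul_eq hb _ le_rfl]
      refine coact_congr fun u => ?_
      rw [deltaN_forest, tmul_cut]
    rw [hl, coact_cut_self (isPrimitive_generic hb), deltaN_forest, map_cut, map_cut]
    refine cut_congr fun p q => ?_
    rw [TensorProduct.map_tmul, h, rho_forest hb, rho_forest hb, map₂_coact hb]
    rfl
  | hadd a c ha hc => simp only [map_add, ha, hc]
  | hsmul r a ha => simp only [map_smul, ha]

end Cointeraction

end LieButcher

end

theorem mainTheorem2 {K : Type*} [Field K] [CharZero K] {ι : Type*}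
    (β : ι → LieButcher.LieMonomial) (b : Module.Basis ι K (LieButcher.LiePT K))
    (hb : ∀ i, b i = LieButcher.LieMonomial.eval K (β i)) :
    LieButcher.InCointeraction
      (LieButcher.shuffle K) (LieButcher.forest K []) (LieButcher.deltaN K)
      (LieButcher.coeff K [])
      (LinearMap.mul K (LieButcher.Q K)) 1 (LieButcher.deltaQ β b).toLinearMap
      (LieButcher.epsilonQ (K := K)).toLinearMap
      (LieButcher.rho b) := by
  open LieButcher in
  refine
    { bialgebra_left := isBialgebra_deltaN K
      bialgebra_right := isBialgebra_deltaQ hb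
      coaction_coassoc := fun x => ?_
      coaction_counit := fun x => ?_
      map_one := by rw [rho_forest hb, coact_nil]
      map_mul := rho_shuffle hb
      map_counit := fun x => ?_
      map_comul := deltaN_rho hb }
  · induction x using forestSpan_induction with
    | hw w => exact assoc_deltaQ_coact hb (forest K) (rho_forest hb) w
    | hadd a c ha hc => simp only [map_add, ha, hc]
    | hsmul r a ha => simp only [map_smul, ha]
  · induction x using forestSpan_induction with
    | hw w => rw [rho_forest hb, lid_epsilonQ_coact hb]
    | hadd a c ha hc => simp only [map_add, ha, hc]
    | hsmul r a ha => simp only [map_smul, ha]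
  · induction x using forestSpan_induction with
    | hw w =>
      have h (u : Forest) : TensorProduct.rid K (Q K) ((coeff K []).lTensor (Q K)
          (seriesForest (generic b) u w ⊗ₜ[K] forest K u)) =
          coeff K u (forest K []) • seriesForest (generic b) u w := by
        rw [LinearMap.lTensor_tmul, TensorProduct.rid_tmul, coeff_forest_comm]
      rw [rho_forest hb, coact_tmul_eq hb _ le_rfl, map_lsum, map_lsum]
      simp only [h]
      rw [lsum_coeff_forest_smul (Nat.zero_le _) fun u => seriesForest (generic b) u w,
        seriesForest_nil, coeff_nil_forest]
      cases w <;> simp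
    | hadd a c ha hc => simp only [map_add, ha, hc, add_smul]
    | hsmul r a ha => simp only [map_smul, ha, smul_eq_mul, mul_smul]
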